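/- Let $k$ be a field and let $R=\begin{pmatrix} k & k^2\\ 0 & k\end{pmatrix}$ be the Kronecker algebra, where $k^2$ is a $k$-$k$-bimodule by $a(b,c)d=(abd,acd)$. A representation $\alpha,\beta\colon M_2\rightrightarrows M_1$ of the Kronecker quiver over $k$ is regarded as the left $R$-module of column vectors $(m_1,m_2)^{T}$, with action $$\begin{pmatrix} a & (c,d)\\ 0 & b\end{pmatrix}\begin{pmatrix} m_1\\ m_2\end{pmatrix}=\begin{pmatrix} a m_1+c\,\alpha(m_2)+d\,\beta(m_2)\\ b\, m_2\end{pmatrix}.$$ Let $V$ be the module given by $0,1\colon k\rightrightarrows k$ and, for a monic irreducible polynomial $p\in k[x]$, let $V_{p}$ be the module given by $1,x\colon k[x]/(p)\rightrightarrows k[x]/(p)$. Let $\Delta$ be any set of monic irreducible polynomials in $k[x]$, and let $\mathcal U=\{V\}\cup\{V_{p}\mid p\in\Delta\}$. A universal localization of $R$ at $\mathcal U$ is a ring homomorphism $\lambda\colon R\to R_{\mathcal U}$ for which there are exact sequences $0\to P_U\xrightarrow{f_U}Q_U\to U\to 0$ with $P_U,Q_U$ finitely generated projective, one for each $U\in\mathcal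 U$, such that $R_{\mathcal U}\otimes_R f_U$ is an isomorphism for all $U\in\mathcal U$ and every ring homomorphism $R\to T$ for which all $T\otimes_R f_U$ are isomorphisms factors uniquely through $\lambda$. Let $D$ be the smallest subring of $k(x)$ that contains $k[x]$ and $\frac1{p}$ for all $p\in\Delta$. Then $D$ is a Dedekind domain (fields allowed), a universal localization of $R$ at $\mathcal U$ exists and is realized by a ring homomorphism $R\to M_2(D)$, and for every universal localization $R\to R_{\mathcal U}$ of $R$ at $\mathcal U$ there is a ring isomorphism $R_{\mathcal U}\cong M_2(D)$. In particular, $R_{\mathcal U}$ is Morita equivalent to $D$. -/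

import Mathlib

open Polynomial
open scoped TensorProduct

universe u

/-! ### Extension of scalars along a homomorphism of (noncommutative) rings -/

section ExtendScalars

variable {R S : Type u} [Ring R] [Ring S] (φ : R →+* S)

/-- The relations `(s φ(r)) ⊗ p = s ⊗ (r p)` that cut `S ⊗_R P` out of `S ⊗_ℤ P`. -/
def balancedRelations (P : Type u) [AddCommGroup P] [Module R P] : Submodule S (S ⊗[ℤ] P) :=
  Submodule.span S
    {z | ∃ (s : S) (r : R) (p : P), z = (s * φ r) ⊗ₜ[ℤ] p - s ⊗ₜ[ℤ] (r • p)}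

/-- The left `S`-module `S ⊗_R P`, where `S` is a right `R`-module through `φ : R → S`. -/
abbrev ExtendedModule (P : Type u) [AddCommGroup P] [Module R P] : Type u :=
  (S ⊗[ℤ] P) ⧸ balancedRelations φ P

/-- `id ⊗ f : S ⊗_ℤ P → S ⊗_ℤ Q` as an `S`-linear map. -/
noncomputable def intTensorMap {P Q : Type u} [AddCommGroup P] [Module R P]
    [AddCommGroup Q] [Module R Q] (f : P →ₗ[R] Q) : S ⊗[ℤ] P →ₗ[S] S ⊗[ℤ] Q :=
  TensorProduct.AlgebraTensorModule.map (LinearMap.id : S →ₗ[S] S) f.toAddMonoidHom.toIntLinearMap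

theorem balancedRelations_le_comap {P Q : Type u} [AddCommGroup P] [Module R P]
    [AddCommGroup Q] [Module R Q] (f : P →ₗ[R] Q) :
    balancedRelations φ P ≤ (balancedRelations φ Q).comap (intTensorMap (S := S) f) := by
  refine Submodule.span_le.2 ?_
  rintro _ ⟨s, r, p, rfl⟩
  refine Submodule.subset_span ⟨s, r, f p, ?_⟩
  simp [intTensorMap]

/-- The `S`-linear map `S ⊗_R f : S ⊗_R P → S ⊗_R Q`. -/
noncomputable def extendedMap {P Q : Type u} [AddCommGroup P] [Module R P]
    [AddCommGroup Q] [Module R Q] (f : P →ₗ[R] Q) :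
    ExtendedModule φ P →ₗ[S] ExtendedModule φ Q :=
  Submodule.mapQ _ _ (intTensorMap f) (balancedRelations_le_comap φ f)

end ExtendScalars

/-! ### Universal localization -/

/-- A homomorphism between finitely generated projective left `R`-modules. -/
structure FGProjMap (R : Type u) [Ring R] where
  P : Type u
  Q : Type u
  [addCommGroupP : AddCommGroup P]
  [addCommGroupQ : AddCommGroup Q]
  [moduleP : Module R P]
  [moduleQ : Module R Q]
  [finiteP : Module.Finite R P]
  [finiteQ : Module.Finite R Q]
  [projectiveP : Module.Projective R P]
  [projectiveQ : Module.Projective R Q]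
  map : P →ₗ[R] Q

attribute [instance] FGProjMap.addCommGroupP FGProjMap.addCommGroupQ
  FGProjMap.moduleP FGProjMap.moduleQ FGProjMap.finiteP FGProjMap.finiteQ
  FGProjMap.projectiveP FGProjMap.projectiveQ

/-- `φ : R → S` is `Σ`-inverting: `S ⊗_R α` is an isomorphism for every `α ∈ Σ`. -/
def IsInverting {R S : Type u} [Ring R] [Ring S] (Sig : Set (FGProjMap R)) (φ : R →+* S) : Prop :=
  ∀ α ∈ Sig, Function.Bijective (extendedMap φ α.map)

/-- `φ : R → S` is the universal localization of `R` at `Σ`: it is `Σ`-inverting, and every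
`Σ`-inverting homomorphism factors uniquely through it. -/
structure IsUniversalLocalization {R S : Type u} [Ring R] [Ring S]
    (Sig : Set (FGProjMap R)) (φ : R →+* S) : Prop where
  inverting : IsInverting Sig φ
  universal : ∀ (T : Type u) [Ring T] (θ : R →+* T), IsInverting Sig θ →
    ∃! ψ : S →+* T, ψ.comp φ = θ

/-- An exact sequence `0 → P → Q → U → 0` with `P`, `Q` finitely generated projective. -/
structure FGProjPresentation (R : Type u) [Ring R] (U : Type u) [AddCommGroup U] [Module R U]
    extends FGProjMap R where
  proj : Q →ₗ[R] U
  injective : Function.Injective map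
  exact : Function.Exact map proj
  surjective : Function.Surjective proj

/-- `φ : R → S` is a universal localization of `R` at the set `𝒰` of modules: it is the universal
localization at `{f_U | U ∈ 𝒰}` for some choice of finitely generated projective presentations
`f_U`, one for each `U ∈ 𝒰`. -/
def IsUniversalLocalizationAt {R S : Type u} [Ring R] [Ring S]
    (𝒰 : Set (ModuleCat.{u} R)) (φ : R →+* S) : Prop :=
  ∃ f : ∀ U : 𝒰, FGProjPresentation R U.1,
    IsUniversalLocalization (Set.range fun U => (f U).toFGProjMap) φ

/-! ### The Kronecker algebra -/

/-- The triangular matrix ring with entries `a`, `v`, `0`, `b`, where `a, b ∈ k` and `v ∈ k²`. -/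
@[ext]
structure KroneckerAlgebra (k : Type u) where
  a : k
  v : k × k
  b : k

namespace KroneckerAlgebra

variable {k : Type u} [Field k]

instance : Zero (KroneckerAlgebra k) := ⟨⟨0, 0, 0⟩⟩
instance : One (KroneckerAlgebra k) := ⟨⟨1, 0, 1⟩⟩
instance : Add (KroneckerAlgebra k) := ⟨fun r s => ⟨r.a + s.a, r.v + s.v, r.b + s.b⟩⟩
instance : Neg (KroneckerAlgebra k) := ⟨fun r => ⟨-r.a, -r.v, -r.b⟩⟩
instance : Mul (KroneckerAlgebra k) :=
  ⟨fun r s => ⟨r.a * s.a, r.a • s.v + s.b • r.v, r.b * s.b⟩⟩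

@[simp] theorem zero_a : (0 : KroneckerAlgebra k).a = 0 := rfl
@[simp] theorem zero_v : (0 : KroneckerAlgebra k).v = 0 := rfl
@[simp] theorem zero_b : (0 : KroneckerAlgebra k).b = 0 := rfl
@[simp] theorem one_a : (1 : KroneckerAlgebra k).a = 1 := rfl
@[simp] theorem one_v : (1 : KroneckerAlgebra k).v = 0 := rfl
@[simp] theorem one_b : (1 : KroneckerAlgebra k).b = 1 := rfl
@[simp] theorem add_a (r s : KroneckerAlgebra k) : (r + s).a = r.a + s.a := rfl
@[simp] theorem add_v (r s : KroneckerAlgebra k) : (r + s).v = r.v + s.v := rfl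
@[simp] theorem add_b (r s : KroneckerAlgebra k) : (r + s).b = r.b + s.b := rfl
@[simp] theorem neg_a (r : KroneckerAlgebra k) : (-r).a = -r.a := rfl
@[simp] theorem neg_v (r : KroneckerAlgebra k) : (-r).v = -r.v := rfl
@[simp] theorem neg_b (r : KroneckerAlgebra k) : (-r).b = -r.b := rfl
@[simp] theorem mul_a (r s : KroneckerAlgebra k) : (r * s).a = r.a * s.a := rfl
@[simp] theorem mul_v (r s : KroneckerAlgebra k) : (r * s).v = r.a • s.v + s.b • r.v := rfl
@[simp] theorem mul_b (r s : KroneckerAlgebra k) : (r * s).b = r.b * s.b := rfl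

instance : Ring (KroneckerAlgebra k) where
  add_assoc _ _ _ := by ext <;> simp [add_assoc]
  zero_add _ := by ext <;> simp
  add_zero _ := by ext <;> simp
  add_comm _ _ := by ext <;> simp [add_comm]
  neg_add_cancel _ := by ext <;> simp
  nsmul := nsmulRec
  zsmul := zsmulRec
  mul_assoc _ _ _ := by ext <;> simp <;> ring
  one_mul _ := by ext <;> simp
  mul_one _ := by ext <;> simp
  zero_mul _ := by ext <;> simp
  mul_zero _ := by ext <;> simp
  left_distrib _ _ _ := by ext <;> simp <;> ring
  right_distrib _ _ _ := by ext <;> simp <;> ring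

/-- The left module over the Kronecker algebra that corresponds to the representation
`α, β : M₂ ⇉ M₁` of the Kronecker quiver: the column vectors `(m₁, m₂)`. -/
@[ext]
structure RepModule {M₁ M₂ : Type u} [AddCommGroup M₁] [AddCommGroup M₂] [Module k M₁] [Module k M₂]
    (α β : M₂ →ₗ[k] M₁) : Type u where
  fst : M₁
  snd : M₂

namespace RepModule

variable {M₁ M₂ : Type u} [AddCommGroup M₁] [AddCommGroup M₂] [Module k M₁] [Module k M₂]
  {α β : M₂ →ₗ[k] M₁}

instance : Zero (RepModule α β) := ⟨⟨0, 0⟩⟩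
instance : Add (RepModule α β) := ⟨fun m n => ⟨m.fst + n.fst, m.snd + n.snd⟩⟩
instance : Neg (RepModule α β) := ⟨fun m => ⟨-m.fst, -m.snd⟩⟩
instance : SMul (KroneckerAlgebra k) (RepModule α β) :=
  ⟨fun r m => ⟨r.a • m.fst + (r.v.1 • α m.snd + r.v.2 • β m.snd), r.b • m.snd⟩⟩

@[simp] theorem zero_fst : (0 : RepModule α β).fst = 0 := rfl
@[simp] theorem zero_snd : (0 : RepModule α β).snd = 0 := rfl
@[simp] theorem add_fst (m n : RepModule α β) : (m + n).fst = m.fst + n.fst := rfl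
@[simp] theorem add_snd (m n : RepModule α β) : (m + n).snd = m.snd + n.snd := rfl
@[simp] theorem neg_fst (m : RepModule α β) : (-m).fst = -m.fst := rfl
@[simp] theorem neg_snd (m : RepModule α β) : (-m).snd = -m.snd := rfl
@[simp] theorem smul_fst (r : KroneckerAlgebra k) (m : RepModule α β) :
    (r • m).fst = r.a • m.fst + (r.v.1 • α m.snd + r.v.2 • β m.snd) := rfl
@[simp] theorem smul_snd (r : KroneckerAlgebra k) (m : RepModule α β) :
    (r • m).snd = r.b • m.snd := rfl

instance : AddCommGroup (RepModule α β) where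
  add_assoc _ _ _ := by ext <;> simp [add_assoc]
  zero_add _ := by ext <;> simp
  add_zero _ := by ext <;> simp
  add_comm _ _ := by ext <;> simp [add_comm]
  neg_add_cancel _ := by ext <;> simp
  nsmul := nsmulRec
  zsmul := zsmulRec

instance : Module (KroneckerAlgebra k) (RepModule α β) where
  one_smul _ := by ext <;> simp
  mul_smul _ _ _ := by ext <;> simp <;> module
  smul_zero _ := by ext <;> simp
  smul_add _ _ _ := by ext <;> simp <;> module
  add_smul _ _ _ := by ext <;> simp <;> module
  zero_smul _ := by ext <;> simp

end RepModule

variable (k)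

/-- The simple regular module `V`: the representation `0, 1 : k ⇉ k`. -/
def simpleV : ModuleCat.{u} (KroneckerAlgebra k) :=
  ModuleCat.of _ (RepModule (0 : k →ₗ[k] k) LinearMap.id)

/-- The module `V_p`: the representation `1, x : k[x]/(p) ⇉ k[x]/(p)`. -/
noncomputable def simpleVp (p : k[X]) : ModuleCat.{u} (KroneckerAlgebra k) :=
  ModuleCat.of _ (RepModule (LinearMap.id : AdjoinRoot p →ₗ[k] AdjoinRoot p)
    (LinearMap.mulLeft k (AdjoinRoot.root p)))

/-- The set of modules `{V} ∪ {V_p | p ∈ Δ}`. -/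
def localizingSet (Δ : Set k[X]) : Set (ModuleCat.{u} (KroneckerAlgebra k)) :=
  {simpleV k} ∪ {U | ∃ p ∈ Δ, U = simpleVp k p}

/-- The smallest subring of `k(x)` that contains `k[x]` and `1 / p` for all `p ∈ Δ`. -/
noncomputable def invertedSubring (Δ : Set k[X]) : Subring (RatFunc k) :=
  Subring.closure (Set.range (algebraMap k[X] (RatFunc k)) ∪
    {f | ∃ p ∈ Δ, f = 1 / algebraMap k[X] (RatFunc k) p})

end KroneckerAlgebra

/-!
For a homomorphism `θ : R → T`, the map `T ⊗_R f` is an isomorphism if and only if `f` induces a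
bijection `Hom_R(Q, N) → Hom_R(P, N)` for every `T`-module `N`. If `f : P → Q` resolves `U`, this
says that `Hom_R(U, N)` and `Ext¹_R(U, N)` vanish, so any presentation of `U` may be used to test
it, in particular the standard one. For `V` the condition is that `α` is bijective on `N`, and for
all `N` together that `θ(α)` has an inverse between the two Peirce corners of `T`; the idempotents,
`θ(α)` and its inverse are then 2 × 2 matrix units. The element `α⁻¹β + βα⁻¹` commutes with them, so
evaluation at it maps `k[x]` into their centralizer, and the condition for `V_p` is that `p` becomes
a unit. Hence a localizing homomorphism out of `R` is the same as a homomorphism out of `M₂(D)`.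
-/

section ExtensionOfScalars

variable {R S : Type u} [Ring R] [Ring S] {φ : R →+* S}
variable {P Q : Type u} [AddCommGroup P] [Module R P] [AddCommGroup Q] [Module R Q]
variable {N : Type u} [AddCommGroup N] [Module R N] [Module S N]

theorem mk_tmul_eq_smul (s : S) (p : P) :
    (balancedRelations φ P).mkQ (s ⊗ₜ[ℤ] p) = s • (balancedRelations φ P).mkQ (1 ⊗ₜ[ℤ] p) := by
  rw [← map_smul, TensorProduct.smul_tmul', smul_eq_mul, mul_one]

theorem mk_one_tmul_smul (r : R) (p : P) :
    (balancedRelations φ P).mkQ (1 ⊗ₜ[ℤ] (r • p)) =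
      φ r • (balancedRelations φ P).mkQ (1 ⊗ₜ[ℤ] p) := by
  rw [← mk_tmul_eq_smul, eq_comm, ← sub_eq_zero, ← map_sub, Submodule.mkQ_apply,
    Submodule.Quotient.mk_eq_zero]
  exact Submodule.subset_span ⟨1, r, p, by rw [one_mul]⟩

theorem extendedMap_mk (f : P →ₗ[R] Q) (p : P) :
    extendedMap φ f ((balancedRelations φ P).mkQ (1 ⊗ₜ[ℤ] p)) =
      (balancedRelations φ Q).mkQ (1 ⊗ₜ[ℤ] f p) := by
  simp [extendedMap, intTensorMap]

/-- The adjunction `Hom_S(S ⊗_R P, N) ≃ Hom_R(P, N)` between extension and restriction of scalars,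
for an `S`-module `N` whose `R`-module structure is its restriction along `φ`. -/
noncomputable def extendedHomEquiv (hN : ∀ (r : R) (n : N), φ r • n = r • n) :
    (ExtendedModule φ P →ₗ[S] N) ≃ (P →ₗ[R] N) where
  toFun h :=
    { toFun := fun p => h ((balancedRelations φ P).mkQ (1 ⊗ₜ[ℤ] p))
      map_add' := fun p q => by rw [TensorProduct.tmul_add, map_add, map_add]
      map_smul' := fun r p => by rw [mk_one_tmul_smul, map_smul, hN, RingHom.id_apply] }
  invFun g := (balancedRelations φ P).liftQ
    (TensorProduct.AlgebraTensorModule.lift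
      { toFun := fun s => s • g.toAddMonoidHom.toIntLinearMap
        map_add' := fun s t => by ext; simp [add_smul]
        map_smul' := fun s t => by ext; simp [mul_smul] } : S ⊗[ℤ] P →ₗ[S] N) <| by
    rw [balancedRelations, Submodule.span_le]
    rintro _ ⟨s, r, p, rfl⟩
    simp [mul_smul, hN]
  left_inv h := by
    refine Submodule.linearMap_qext _ (TensorProduct.AlgebraTensorModule.ext fun s p => ?_)
    rw [LinearMap.comp_apply, LinearMap.comp_apply, mk_tmul_eq_smul, map_smul, map_smul]
    simp
  right_inv g := by ext; simp

theorem extendedHomEquiv_comp_extendedMap (hN : ∀ (r : R) (n : N), φ r • n = r • n)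
    (f : P →ₗ[R] Q) (h : ExtendedModule φ Q →ₗ[S] N) :
    extendedHomEquiv hN (h ∘ₗ extendedMap φ f) = extendedHomEquiv hN h ∘ₗ f :=
  LinearMap.ext fun p => congrArg h (extendedMap_mk f p)

theorem bijective_iff_forall_bijective_comp {M M' : Type u} [AddCommGroup M] [Module S M]
    [AddCommGroup M'] [Module S M'] (f : M →ₗ[S] M') :
    Function.Bijective f ↔ ∀ (N : Type u) [AddCommGroup N] [Module S N],
      Function.Bijective fun h : M' →ₗ[S] N => h ∘ₗ f := by
  refine ⟨fun hf N _ _ => ⟨fun h h' hh => ?_, fun h => ?_⟩, fun H => ?_⟩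
  · exact (LinearMap.cancel_right hf.2).1 hh
  · exact ⟨h ∘ₗ (LinearEquiv.ofBijective f hf).symm, by ext x; simp⟩
  · obtain ⟨g, hg : g ∘ₗ f = LinearMap.id⟩ := (H M).2 LinearMap.id
    have hg' : f ∘ₗ g = LinearMap.id := (H M').1 <| by
      change (f ∘ₗ g) ∘ₗ f = LinearMap.id ∘ₗ f
      rw [LinearMap.comp_assoc, hg, LinearMap.comp_id, LinearMap.id_comp]
    exact Function.bijective_iff_has_inverse.2 ⟨g, LinearMap.congr_fun hg, LinearMap.congr_fun hg'⟩

theorem bijective_extendedMap_iff (f : P →ₗ[R] Q) :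
    Function.Bijective (extendedMap φ f) ↔
      ∀ (N : Type u) [AddCommGroup N] [Module R N] [Module S N],
        (∀ (r : R) (n : N), φ r • n = r • n) →
          Function.Bijective fun g : Q →ₗ[R] N => g ∘ₗ f := by
  have key (N : Type u) [AddCommGroup N] [Module R N] [Module S N]
      (hN : ∀ (r : R) (n : N), φ r • n = r • n) :
      Function.Bijective (fun h : ExtendedModule φ Q →ₗ[S] N => h ∘ₗ extendedMap φ f) ↔
        Function.Bijective fun g : Q →ₗ[R] N => g ∘ₗ f := by
    rw [← (extendedHomEquiv hN).bijective.of_comp_iff',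
      ← (extendedHomEquiv hN).bijective.of_comp_iff]
    exact iff_of_eq (congrArg _ (funext (extendedHomEquiv_comp_extendedMap hN f)))
  rw [bijective_iff_forall_bijective_comp]
  refine ⟨fun H N _ _ _ hN => (key N hN).1 (H N), fun H N _ _ => ?_⟩
  let _ : Module R N := Module.compHom N φ
  exact (key N fun _ _ => rfl).2 (H N fun _ _ => rfl)

end ExtensionOfScalars

namespace FGProjPresentation

open CategoryTheory Abelian

variable {R : Type u} [Ring R] {U : Type u} [AddCommGroup U] [Module R U]

theorem shortExact (F : FGProjPresentation R U) :
    (ModuleCat.shortComplexOfCompEqZero F.map F.proj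
      F.exact.linearMap_comp_eq_zero).ShortExact :=
  ModuleCat.shortComplex_shortExact _ F.exact F.injective F.surjective

variable {N : Type u} [AddCommGroup N] [Module R N]

theorem injective_comp_map_iff (F : FGProjPresentation R U) :
    Function.Injective (fun g : F.Q →ₗ[R] N => g ∘ₗ F.map) ↔ Subsingleton (U →ₗ[R] N) := by
  refine ⟨fun hF => ⟨fun g h => ?_⟩, fun hU g g' hg => ?_⟩
  · refine (LinearMap.cancel_right F.surjective).1 (hF ?_)
    simp only [LinearMap.comp_assoc, F.exact.linearMap_comp_eq_zero, LinearMap.comp_zero]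
  · have hker : LinearMap.range F.map ≤ LinearMap.ker (g - g') := by
      rintro _ ⟨x, rfl⟩
      simpa [sub_eq_zero] using LinearMap.congr_fun hg x
    let e := F.exact.linearEquivOfSurjective F.surjective
    have h0 : (LinearMap.range F.map).liftQ (g - g') hker ∘ₗ e.symm.toLinearMap = 0 :=
      Subsingleton.elim _ _
    ext q
    simpa [e, sub_eq_zero] using LinearMap.congr_fun h0 (F.proj q)

theorem surjective_comp_map_iff (F : FGProjPresentation R U) :
    Function.Surjective (fun g : F.Q →ₗ[R] N => g ∘ₗ F.map) ↔
      Subsingleton (Ext (ModuleCat.of R U) (ModuleCat.of R N) 1) := by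
  refine ⟨fun hF => subsingleton_of_forall_eq 0 fun x => ?_, fun hU g => ?_⟩
  · obtain ⟨y, rfl⟩ := Ext.contravariant_sequence_exact₃ F.shortExact _ x
      (Ext.eq_zero_of_projective (P := ModuleCat.of R F.Q) _) (add_zero 1)
    obtain ⟨y, rfl⟩ := Ext.mk₀_bijective _ _ |>.2 y
    obtain ⟨g, hg⟩ := hF y.hom
    obtain rfl : ModuleCat.ofHom F.map ≫ ModuleCat.ofHom g = y := by
      exact ModuleCat.hom_ext hg
    rw [← Ext.mk₀_comp_mk₀]
    exact F.shortExact.extClass_comp_assoc _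
  · obtain ⟨y, hy⟩ := Ext.contravariant_sequence_exact₁ F.shortExact _
      (Ext.mk₀ (ModuleCat.ofHom g)) (add_zero 1) (hU.elim _ _)
    obtain ⟨h, rfl⟩ := (Ext.mk₀_bijective _ _).2 y
    rw [Ext.mk₀_comp_mk₀] at hy
    exact ⟨h.hom, congrArg ModuleCat.Hom.hom ((Ext.mk₀_bijective _ _).1 hy)⟩

theorem bijective_comp_map_iff (F : FGProjPresentation R U) :
    Function.Bijective (fun g : F.Q →ₗ[R] N => g ∘ₗ F.map) ↔
      Subsingleton (U →ₗ[R] N) ∧ Subsingleton (Ext (ModuleCat.of R U) (ModuleCat.of R N) 1) :=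
  and_congr F.injective_comp_map_iff F.surjective_comp_map_iff

end FGProjPresentation

/-! ### The Sylvester operator on maps out of `k[x]/(p)` -/

section Sylvester

variable {k : Type*}

/-- In a commutative square of surjections, an endomorphism induced on the kernel `A` of `π`
by `δ` and one induced on the kernel `B` of `δ` by `π` have the same kernel and cokernel. -/
theorem bijective_of_bijective_ker [CommRing k] {A B H : Type*} [AddCommGroup A] [Module k A]
    [AddCommGroup B] [Module k B] [AddCommGroup H] [Module k H]
    {i : A →ₗ[k] H} {j : B →ₗ[k] H} {π δ : Module.End k H} {a : Module.End k A} {b : Module.End k B}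
    (hi : Function.Injective i) (hiπ : Function.Exact i π) (hπ : Function.Surjective π)
    (hj : Function.Injective j) (hjδ : Function.Exact j δ)
    (hcomm : Commute π δ) (hia : i ∘ₗ a = δ ∘ₗ i) (hjb : j ∘ₗ b = π ∘ₗ j)
    (ha : Function.Bijective a) : Function.Bijective b := by
  replace hcomm (h : H) : π (δ h) = δ (π h) := LinearMap.congr_fun hcomm h
  replace hia (c : A) : i (a c) = δ (i c) := LinearMap.congr_fun hia c
  replace hjb (w : B) : j (b w) = π (j w) := LinearMap.congr_fun hjb w
  refine ⟨(injective_iff_map_eq_zero b).2 fun w hw => ?_, fun w => ?_⟩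
  · obtain ⟨c, hc⟩ := (hiπ (j w)).1 (by rw [← hjb, hw, map_zero])
    have hac : a c = 0 := hi (by rw [hia, hc, hjδ.apply_apply_eq_zero, map_zero])
    rw [← map_zero a] at hac
    exact hj (by rw [← hc, ha.1 hac, map_zero, map_zero])
  · obtain ⟨h, hh⟩ := hπ (j w)
    obtain ⟨c, hc⟩ := (hiπ (δ h)).1 (by rw [hcomm, hh, hjδ.apply_apply_eq_zero])
    obtain ⟨c, rfl⟩ := ha.2 c
    obtain ⟨w', hw'⟩ := (hjδ (h - i c)).1 (by rw [map_sub, ← hia, hc, sub_self])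
    exact ⟨w', hj (by rw [hjb, hw', map_sub, hiπ.apply_apply_eq_zero, sub_zero, hh])⟩

section

variable [CommRing k] {E W : Type*} [AddCommGroup E] [Module k E] [AddCommGroup W] [Module k W]

/-- The Sylvester operator `g ↦ g σ - τ g` on linear maps. -/
noncomputable def sylvester (σ : Module.End k E) (τ : Module.End k W) :
    Module.End k (E →ₗ[k] W) :=
  LinearMap.lcomp k W σ - LinearMap.compRight k τ

theorem sylvester_apply (σ : Module.End k E) (τ : Module.End k W) (g : E →ₗ[k] W) (z : E) :
    sylvester σ τ g z = g (σ z) - τ (g z) := rfl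

/-- Intertwiners from multiplication by `X` to `τ` are determined by the image of `1`. -/
theorem exact_aeval_sylvester_mulLeft_X (τ : Module.End k W) :
    Function.Exact (aeval τ).toLinearMap.flip (sylvester (LinearMap.mulLeft k (X : k[X])) τ) := by
  intro h
  refine ⟨fun hh => ⟨h 1, ?_⟩, ?_⟩
  · have hX (f : k[X]) : h (X * f) = τ (h f) := sub_eq_zero.1 (LinearMap.congr_fun hh f)
    refine LinearMap.ext fun f => ?_
    simp only [LinearMap.flip_apply, AlgHom.toLinearMap_apply]
    induction f using Polynomial.induction_on with
    | C c => rw [aeval_C, Module.algebraMap_end_apply, ← mul_one (C c), C_mul', map_smul]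
    | add f g hf hg => rw [map_add, map_add, LinearMap.add_apply, hf, hg]
    | monomial n c ih =>
      rw [pow_succ', mul_left_comm, hX, ← ih, map_mul, aeval_X, Module.End.mul_apply]
  · rintro ⟨w, rfl⟩
    ext n
    simp [sylvester_apply, pow_succ']

theorem surjective_sylvester_mulLeft_X (τ : Module.End k W) :
    Function.Surjective (sylvester (LinearMap.mulLeft k (X : k[X])) τ) := by
  intro h
  let s : ℕ → W := fun n => Nat.rec 0 (fun n w => h (monomial n 1) + τ w) n
  let g : k[X] →ₗ[k] W := (basisMonomials k).constr k s
  have hg (n : ℕ) : g (monomial n 1) = s n := by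
    rw [← congrFun (coe_basisMonomials k) n, Module.Basis.constr_basis]
  refine ⟨g, (basisMonomials k).ext fun n => ?_⟩
  rw [coe_basisMonomials, sylvester_apply, LinearMap.mulLeft_apply, X_mul_monomial, hg, hg,
    sub_eq_iff_eq_add]

end

theorem exact_mulLeft_mkₐ [CommRing k] (p : k[X]) :
    Function.Exact (LinearMap.mulLeft k p) (AdjoinRoot.mkₐ (R := k) p).toLinearMap :=
  fun _ => AdjoinRoot.mk_eq_zero.trans (exists_congr fun _ => eq_comm)

theorem surjective_lcomp_mulLeft [Field k] {W : Type*} [AddCommGroup W] [Module k W] {p : k[X]}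
    (hp : p ≠ 0) : Function.Surjective (LinearMap.lcomp k W (LinearMap.mulLeft k p)) := by
  obtain ⟨q, hq⟩ := (LinearMap.mulLeft k p).exists_leftInverse_of_injective
    (LinearMap.ker_eq_bot.2 (mul_right_injective₀ hp))
  exact fun h => ⟨h ∘ₗ q, by rw [LinearMap.lcomp_apply', LinearMap.comp_assoc, hq,
    LinearMap.comp_id]⟩

theorem bijective_sylvester_root_iff [Field k] {W : Type*} [AddCommGroup W] [Module k W]
    (τ : Module.End k W) {p : k[X]} (hp : p ≠ 0) :
    Function.Bijective (sylvester (LinearMap.mulLeft k (AdjoinRoot.root p)) τ) ↔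
      Function.Bijective (aeval τ p) := by
  have hi := LinearMap.lcomp_injective_of_surjective (S := k) (N := W)
    (AdjoinRoot.mkₐ (R := k) p).toLinearMap AdjoinRoot.mk_surjective
  have hiπ := LinearMap.exact_lcomp_of_exact_of_surjective W (exact_mulLeft_mkₐ p)
    AdjoinRoot.mk_surjective
  have hj : Function.Injective (aeval (R := k) τ).toLinearMap.flip := fun w w' h => by
    simpa using LinearMap.congr_fun h 1
  have hjδ := exact_aeval_sylvester_mulLeft_X τ
  have hcomm : Commute (LinearMap.lcomp k W (LinearMap.mulLeft k p))
      (sylvester (LinearMap.mulLeft k X) τ) := by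
    refine LinearMap.ext fun h => LinearMap.ext fun f => ?_
    simp [sylvester_apply, mul_left_comm]
  have hia : LinearMap.lcomp k W (AdjoinRoot.mkₐ (R := k) p).toLinearMap ∘ₗ
      sylvester (LinearMap.mulLeft k (AdjoinRoot.root p)) τ =
        sylvester (LinearMap.mulLeft k X) τ ∘ₗ
          LinearMap.lcomp k W (AdjoinRoot.mkₐ (R := k) p).toLinearMap := by
    refine LinearMap.ext fun h => LinearMap.ext fun f => ?_
    simp [sylvester_apply]
  have hjb : (aeval (R := k) τ).toLinearMap.flip ∘ₗ aeval τ p =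
      LinearMap.lcomp k W (LinearMap.mulLeft k p) ∘ₗ (aeval (R := k) τ).toLinearMap.flip := by
    refine LinearMap.ext fun w => LinearMap.ext fun f => ?_
    simp [← Module.End.mul_apply, ← map_mul, mul_comm]
  exact ⟨bijective_of_bijective_ker hi hiπ (surjective_lcomp_mulLeft hp) hj hjδ hcomm hia hjb,
    bijective_of_bijective_ker hj hjδ (surjective_sylvester_mulLeft_X τ) hi hiπ hcomm.symm hjb hia⟩

end Sylvester

/-! ### Modules over the Kronecker algebra as representations -/

namespace KroneckerAlgebra

section Elements

variable (k : Type u) [Field k]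

/-- The embedding of `k` as the scalar matrices, which makes the Kronecker algebra a `k`-algebra. -/
def scalar : k →+* KroneckerAlgebra k where
  toFun c := ⟨c, 0, c⟩
  map_one' := rfl
  map_zero' := rfl
  map_mul' c d := by ext <;> simp
  map_add' c d := by ext <;> simp

/-- The idempotent of the vertex that carries `M₁`. -/
def idem₁ : KroneckerAlgebra k := ⟨1, 0, 0⟩

/-- The idempotent of the vertex that carries `M₂`. -/
def idem₂ : KroneckerAlgebra k := ⟨0, 0, 1⟩

/-- The arrow of the Kronecker quiver that acts as `α`. -/
def arrow₁ : KroneckerAlgebra k := ⟨0, (1, 0), 0⟩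

/-- The arrow of the Kronecker quiver that acts as `β`. -/
def arrow₂ : KroneckerAlgebra k := ⟨0, (0, 1), 0⟩

variable {k}

@[simp] theorem scalar_a (c : k) : (scalar k c).a = c := rfl
@[simp] theorem scalar_v (c : k) : (scalar k c).v = 0 := rfl
@[simp] theorem scalar_b (c : k) : (scalar k c).b = c := rfl
@[simp] theorem idem₁_a : (idem₁ k).a = 1 := rfl
@[simp] theorem idem₁_v : (idem₁ k).v = 0 := rfl
@[simp] theorem idem₁_b : (idem₁ k).b = 0 := rfl
@[simp] theorem idem₂_a : (idem₂ k).a = 0 := rfl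
@[simp] theorem idem₂_v : (idem₂ k).v = 0 := rfl
@[simp] theorem idem₂_b : (idem₂ k).b = 1 := rfl
@[simp] theorem arrow₁_a : (arrow₁ k).a = 0 := rfl
@[simp] theorem arrow₁_v : (arrow₁ k).v = (1, 0) := rfl
@[simp] theorem arrow₁_b : (arrow₁ k).b = 0 := rfl
@[simp] theorem arrow₂_a : (arrow₂ k).a = 0 := rfl
@[simp] theorem arrow₂_v : (arrow₂ k).v = (0, 1) := rfl
@[simp] theorem arrow₂_b : (arrow₂ k).b = 0 := rfl

instance : Algebra k (KroneckerAlgebra k) :=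
  (scalar k).toAlgebra' fun c r => by ext <;> simp [mul_comm]

theorem field_smul_def (c : k) (r : KroneckerAlgebra k) : c • r = scalar k c * r := rfl

theorem mul_idem₁ (r : KroneckerAlgebra k) : r * idem₁ k = r.a • idem₁ k := by
  rw [field_smul_def]; ext <;> simp

theorem mul_idem₂ (r : KroneckerAlgebra k) :
    r * idem₂ k = r.v.1 • arrow₁ k + r.v.2 • arrow₂ k + r.b • idem₂ k := by
  simp only [field_smul_def]; ext <;> simp

theorem idem₁_add_idem₂ : idem₁ k + idem₂ k = 1 := by ext <;> simp
theorem idem₁_mul_arrow₁ : idem₁ k * arrow₁ k = arrow₁ k := by ext <;> simp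
theorem idem₁_mul_arrow₂ : idem₁ k * arrow₂ k = arrow₂ k := by ext <;> simp
theorem arrow₁_mul_idem₂ : arrow₁ k * idem₂ k = arrow₁ k := by ext <;> simp
theorem arrow₂_mul_idem₂ : arrow₂ k * idem₂ k = arrow₂ k := by ext <;> simp
theorem arrow₁_mul_arrow₂ : arrow₁ k * arrow₂ k = 0 := by ext <;> simp
theorem arrow₂_mul_arrow₁ : arrow₂ k * arrow₁ k = 0 := by ext <;> simp
theorem idem₂_mul_arrow₂ : idem₂ k * arrow₂ k = 0 := by ext <;> simp
theorem idem₂_mul_arrow₁ : idem₂ k * arrow₁ k = 0 := by ext <;> simp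
theorem arrow₂_mul_idem₁ : arrow₂ k * idem₁ k = 0 := by ext <;> simp
theorem idem₁_mul_idem₂ : idem₁ k * idem₂ k = 0 := by ext <;> simp
theorem idem₁_mul_idem₁ : idem₁ k * idem₁ k = idem₁ k := by ext <;> simp
theorem idem₂_mul_idem₁ : idem₂ k * idem₁ k = 0 := by ext <;> simp
theorem arrow₁_mul_idem₁ : arrow₁ k * idem₁ k = 0 := by ext <;> simp
theorem arrow₁_mul_arrow₁ : arrow₁ k * arrow₁ k = 0 := by ext <;> simp
theorem idem₂_mul_idem₂ : idem₂ k * idem₂ k = idem₂ k := by ext <;> simp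

end Elements

section VertexSpace

variable {k : Type u} [Field k]
variable {N : Type*} [AddCommGroup N] [Module (KroneckerAlgebra k) N] [Module k N]
  [IsScalarTower k (KroneckerAlgebra k) N]

variable (N) in
/-- The subspace `eN` on which `e` acts as the identity. For the idempotents `idem₁` and `idem₂`
these are the two vector spaces of the representation that corresponds to the module `N`. -/
def vertexSpace (e : KroneckerAlgebra k) : Submodule k N :=
  LinearMap.eqLocus (Algebra.lsmul k k N e) LinearMap.id

theorem mem_vertexSpace {e : KroneckerAlgebra k} {n : N} : n ∈ vertexSpace N e ↔ e • n = n :=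
  Iff.rfl

theorem smul_mem_vertexSpace {e r : KroneckerAlgebra k} (h : e * r = r) (n : N) :
    r • n ∈ vertexSpace N e := by
  rw [mem_vertexSpace, smul_smul, h]

theorem smul_eq_of_mem_vertexSpace₁ (r : KroneckerAlgebra k) {n : N}
    (hn : n ∈ vertexSpace N (idem₁ k)) : r • n = r.a • n := by
  rw [mem_vertexSpace] at hn
  nth_rw 1 [← hn]
  rw [smul_smul, mul_idem₁, smul_assoc, hn]

theorem smul_eq_of_mem_vertexSpace₂ (r : KroneckerAlgebra k) {n : N}
    (hn : n ∈ vertexSpace N (idem₂ k)) :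
    r • n = r.v.1 • arrow₁ k • n + r.v.2 • arrow₂ k • n + r.b • n := by
  rw [mem_vertexSpace] at hn
  nth_rw 1 [← hn]
  rw [smul_smul, mul_idem₂, add_smul, add_smul, smul_assoc, smul_assoc, smul_assoc, hn]

variable (k N) in
/-- The structure map `α` of the representation that corresponds to the module `N`. -/
def arrowMap₁ : vertexSpace N (idem₂ k) →ₗ[k] vertexSpace N (idem₁ k) :=
  (Algebra.lsmul k k N (arrow₁ k)).restrict fun n _ => smul_mem_vertexSpace idem₁_mul_arrow₁ n

variable (k N) in
/-- The structure map `β` of the representation that corresponds to the module `N`. -/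
def arrowMap₂ : vertexSpace N (idem₂ k) →ₗ[k] vertexSpace N (idem₁ k) :=
  (Algebra.lsmul k k N (arrow₂ k)).restrict fun n _ => smul_mem_vertexSpace idem₁_mul_arrow₂ n

@[simp] theorem coe_arrowMap₁ (n : vertexSpace N (idem₂ k)) :
    (arrowMap₁ k N n : N) = arrow₁ k • (n : N) := rfl

variable {N' : Type*} [AddCommGroup N'] [Module (KroneckerAlgebra k) N'] [Module k N']
  [IsScalarTower k (KroneckerAlgebra k) N']

/-- The restriction `eN → eN'` of a homomorphism `N → N'`. -/
def vertexMap (e : KroneckerAlgebra k) (f : N →ₗ[KroneckerAlgebra k] N') :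
    vertexSpace N e →ₗ[k] vertexSpace N' e :=
  (f.restrictScalars k).restrict fun n hn => by
    rw [mem_vertexSpace, LinearMap.restrictScalars_apply, ← map_smul, mem_vertexSpace.1 hn]

theorem surjective_vertexMap {e : KroneckerAlgebra k} (he : e * e = e)
    {f : N →ₗ[KroneckerAlgebra k] N'} (hf : Function.Surjective f) :
    Function.Surjective (vertexMap e f) := by
  rintro ⟨n', hn'⟩
  obtain ⟨n, rfl⟩ := hf n'
  exact ⟨⟨e • n, smul_mem_vertexSpace he n⟩, Subtype.ext ((map_smul f e n).trans hn')⟩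

end VertexSpace

namespace RepModule

variable {k M₁ M₂ : Type u} [Field k] [AddCommGroup M₁] [AddCommGroup M₂] [Module k M₁]
  [Module k M₂] {α β : M₂ →ₗ[k] M₁}

instance : Module k (RepModule α β) := Module.compHom _ (scalar k)

instance : IsScalarTower k (KroneckerAlgebra k) (RepModule α β) :=
  IsScalarTower.of_algebraMap_smul fun _ _ => rfl

theorem field_smul_def (c : k) (m : RepModule α β) : c • m = scalar k c • m := rfl

@[simp] theorem field_smul_fst (c : k) (m : RepModule α β) : (c • m).fst = c • m.fst := by
  simp [field_smul_def]

@[simp] theorem field_smul_snd (c : k) (m : RepModule α β) : (c • m).snd = c • m.snd := by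
  simp [field_smul_def]

variable (α β) in
/-- The total space `M₁ ⊕ M₂` of a representation. -/
def linearEquivProd : RepModule α β ≃ₗ[k] M₁ × M₂ where
  toFun m := (m.fst, m.snd)
  invFun m := ⟨m.1, m.2⟩
  map_add' _ _ := rfl
  map_smul' c m := by simp
  left_inv _ := rfl
  right_inv _ := rfl

instance [Module.Finite k M₁] [Module.Finite k M₂] :
    Module.Finite (KroneckerAlgebra k) (RepModule α β) :=
  have : Module.Finite k (RepModule α β) := Module.Finite.equiv (linearEquivProd α β).symm
  Module.Finite.of_restrictScalars_finite k _ _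

variable {N : Type*} [AddCommGroup N] [Module (KroneckerAlgebra k) N] [Module k N]
  [IsScalarTower k (KroneckerAlgebra k) N]

/-- The component at the first vertex of the morphism of representations given by `g`. -/
def fstHom (g : RepModule α β →ₗ[KroneckerAlgebra k] N) : M₁ →ₗ[k] vertexSpace N (idem₁ k) :=
  (g.restrictScalars k ∘ₗ (linearEquivProd α β).symm ∘ₗ LinearMap.inl k M₁ M₂).codRestrict _
    fun x => by
      rw [mem_vertexSpace]
      refine (map_smul g _ _).symm.trans (congrArg g ?_)
      ext <;> simp [linearEquivProd]

/-- The component at the second vertex of the morphism of representations given by `g`. -/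
def sndHom (g : RepModule α β →ₗ[KroneckerAlgebra k] N) : M₂ →ₗ[k] vertexSpace N (idem₂ k) :=
  (g.restrictScalars k ∘ₗ (linearEquivProd α β).symm ∘ₗ LinearMap.inr k M₁ M₂).codRestrict _
    fun x => by
      rw [mem_vertexSpace]
      refine (map_smul g _ _).symm.trans (congrArg g ?_)
      ext <;> simp [linearEquivProd]

@[simp] theorem coe_fstHom (g : RepModule α β →ₗ[KroneckerAlgebra k] N) (x : M₁) :
    (fstHom g x : N) = g ⟨x, 0⟩ := rfl

@[simp] theorem coe_sndHom (g : RepModule α β →ₗ[KroneckerAlgebra k] N) (x : M₂) :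
    (sndHom g x : N) = g ⟨0, x⟩ := rfl

/-- The homomorphism of modules given by a morphism of representations. -/
def lift (u : M₁ →ₗ[k] vertexSpace N (idem₁ k)) (w : M₂ →ₗ[k] vertexSpace N (idem₂ k))
    (hα : u ∘ₗ α = arrowMap₁ k N ∘ₗ w) (hβ : u ∘ₗ β = arrowMap₂ k N ∘ₗ w) :
    RepModule α β →ₗ[KroneckerAlgebra k] N where
  toFun m := u m.fst + w m.snd
  map_add' m m' := by simp only [add_fst, add_snd, map_add, Submodule.coe_add]; abel
  map_smul' r m := by
    have hα' : (u (α m.snd) : N) = arrow₁ k • (w m.snd : N) :=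
      congrArg Subtype.val (LinearMap.congr_fun hα m.snd)
    have hβ' : (u (β m.snd) : N) = arrow₂ k • (w m.snd : N) :=
      congrArg Subtype.val (LinearMap.congr_fun hβ m.snd)
    rw [RingHom.id_apply, smul_add, smul_eq_of_mem_vertexSpace₁ r (u m.fst).2,
      smul_eq_of_mem_vertexSpace₂ r (w m.snd).2, ← hα', ← hβ']
    simp only [smul_fst, smul_snd, map_add, map_smul, Submodule.coe_add, Submodule.coe_smul]
    abel

@[simp] theorem fstHom_lift (u : M₁ →ₗ[k] vertexSpace N (idem₁ k))
    (w : M₂ →ₗ[k] vertexSpace N (idem₂ k)) (hα hβ) :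
    fstHom (lift (α := α) (β := β) u w hα hβ) = u := by
  ext x; simp [lift]

@[simp] theorem sndHom_lift (u : M₁ →ₗ[k] vertexSpace N (idem₁ k))
    (w : M₂ →ₗ[k] vertexSpace N (idem₂ k)) (hα hβ) :
    sndHom (lift (α := α) (β := β) u w hα hβ) = w := by
  ext x; simp [lift]

theorem hom_ext {g h : RepModule α β →ₗ[KroneckerAlgebra k] N} (h₁ : fstHom g = fstHom h)
    (h₂ : sndHom g = sndHom h) : g = h := by
  ext m
  have apply_eq (f : RepModule α β →ₗ[KroneckerAlgebra k] N) :
      f m = fstHom f m.fst + sndHom f m.snd := by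
    rw [coe_fstHom, coe_sndHom, ← map_add]
    congr 1
    ext <;> simp
  rw [apply_eq, apply_eq, h₁, h₂]

theorem fstHom_comp_left (g : RepModule α β →ₗ[KroneckerAlgebra k] N) :
    fstHom g ∘ₗ α = arrowMap₁ k N ∘ₗ sndHom g := by
  ext x
  refine (congrArg g ?_).trans (map_smul g (arrow₁ k) ⟨0, x⟩)
  ext <;> simp [linearEquivProd]

theorem fstHom_comp_right (g : RepModule α β →ₗ[KroneckerAlgebra k] N) :
    fstHom g ∘ₗ β = arrowMap₂ k N ∘ₗ sndHom g := by
  ext x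
  refine (congrArg g ?_).trans (map_smul g (arrow₂ k) ⟨0, x⟩)
  ext <;> simp [linearEquivProd]

end RepModule

variable {k : Type u} [Field k]

/-- The projective module `P₁ ⊗ C ⊕ P₂ ⊗ E` for vector spaces `C` and `E`, where `P₁` and `P₂` are
the two columns of the Kronecker algebra. -/
abbrev ColumnModule (k C E : Type u) [Field k] [AddCommGroup C] [AddCommGroup E] [Module k C]
    [Module k E] : Type u :=
  RepModule (LinearMap.inr k C (E × E) ∘ₗ LinearMap.inl k E E)
    (LinearMap.inr k C (E × E) ∘ₗ LinearMap.inr k E E)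

namespace ColumnModule

variable {C E : Type u} [AddCommGroup C] [AddCommGroup E] [Module k C] [Module k E]
variable {N : Type*} [AddCommGroup N] [Module (KroneckerAlgebra k) N] [Module k N]
  [IsScalarTower k (KroneckerAlgebra k) N]

/-- Homomorphisms out of `P₁ ⊗ C ⊕ P₂ ⊗ E` are pairs of arbitrary linear maps from `C` and `E` to
the two vertex spaces. -/
def homEquiv : (ColumnModule k C E →ₗ[KroneckerAlgebra k] N) ≃
    (C →ₗ[k] vertexSpace N (idem₁ k)) × (E →ₗ[k] vertexSpace N (idem₂ k)) where
  toFun g := (RepModule.fstHom g ∘ₗ LinearMap.inl k C (E × E), RepModule.sndHom g)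
  invFun p := RepModule.lift (p.1.coprod ((arrowMap₁ k N ∘ₗ p.2).coprod (arrowMap₂ k N ∘ₗ p.2))) p.2
    (by rw [← LinearMap.comp_assoc, LinearMap.coprod_inr, LinearMap.coprod_inl])
    (by rw [← LinearMap.comp_assoc, LinearMap.coprod_inr, LinearMap.coprod_inr])
  left_inv g := by
    refine RepModule.hom_ext ?_ (by rw [RepModule.sndHom_lift])
    rw [RepModule.fstHom_lift]
    refine LinearMap.prod_ext (LinearMap.coprod_inl _ _) (LinearMap.prod_ext ?_ ?_)
    · simpa using! (RepModule.fstHom_comp_left g).symm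
    · simpa using! (RepModule.fstHom_comp_right g).symm
  right_inv p := by simp

theorem homEquiv_comp {N' : Type*} [AddCommGroup N'] [Module (KroneckerAlgebra k) N'] [Module k N']
    [IsScalarTower k (KroneckerAlgebra k) N'] (f : N →ₗ[KroneckerAlgebra k] N')
    (g : ColumnModule k C E →ₗ[KroneckerAlgebra k] N) :
    homEquiv (f ∘ₗ g) =
      (vertexMap (idem₁ k) f ∘ₗ (homEquiv g).1, vertexMap (idem₂ k) f ∘ₗ (homEquiv g).2) := rfl

instance : Module.Projective (KroneckerAlgebra k) (ColumnModule k C E) := by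
  refine Module.Projective.of_lifting_property fun {A B} _ _ _ _ f g hf => ?_
  let _ : Module k A := Module.compHom A (scalar k)
  let _ : Module k B := Module.compHom B (scalar k)
  have : IsScalarTower k (KroneckerAlgebra k) A := .of_algebraMap_smul fun _ _ => rfl
  have : IsScalarTower k (KroneckerAlgebra k) B := .of_algebraMap_smul fun _ _ => rfl
  obtain ⟨l₁, hl₁⟩ := Module.projective_lifting_property (vertexMap (idem₁ k) f) (homEquiv g).1
    (surjective_vertexMap idem₁_mul_idem₁ hf)
  obtain ⟨l₂, hl₂⟩ := Module.projective_lifting_property (vertexMap (idem₂ k) f) (homEquiv g).2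
    (surjective_vertexMap idem₂_mul_idem₂ hf)
  refine ⟨homEquiv.symm (l₁, l₂), homEquiv.injective ?_⟩
  rw [homEquiv_comp, Equiv.apply_symm_apply]
  exact Prod.ext hl₁ hl₂

end ColumnModule

variable {M₁ M₂ : Type u} [AddCommGroup M₁] [AddCommGroup M₂] [Module k M₁] [Module k M₂]

/-- The map `P₁ ⊗ M₂² → P₁ ⊗ M₁ ⊕ P₂ ⊗ M₂` in the standard presentation of a representation. -/
def standardMap (α β : M₂ →ₗ[k] M₁) :
    ColumnModule k (M₂ × M₂) PUnit.{u + 1} →ₗ[KroneckerAlgebra k] ColumnModule k M₁ M₂ where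
  toFun m := ⟨(α m.fst.1.1 + β m.fst.1.2, -m.fst.1), 0⟩
  map_add' m n := by ext <;> simp <;> abel
  map_smul' r m := by ext <;> simp

/-- The standard presentation `0 → P₁ ⊗ M₂² → P₁ ⊗ M₁ ⊕ P₂ ⊗ M₂ → M → 0` of a finite-dimensional
representation. -/
def standardPresentation [Module.Finite k M₁] [Module.Finite k M₂] (α β : M₂ →ₗ[k] M₁) :
    FGProjPresentation (KroneckerAlgebra k) (RepModule α β) where
  P := ColumnModule k (M₂ × M₂) PUnit
  Q := ColumnModule k M₁ M₂
  map := standardMap α β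
  proj :=
    { toFun := fun m => ⟨m.fst.1 + α m.fst.2.1 + β m.fst.2.2, m.snd⟩
      map_add' := fun m n => by ext <;> simp; abel
      map_smul' := fun r m => by ext <;> simp; abel }
  injective m n h := by
    have h' : m.fst.1 = n.fst.1 := neg_injective (congrArg (fun z => z.fst.2) h)
    exact RepModule.ext (Prod.ext h' (Subsingleton.elim _ _)) rfl
  exact m := by
    constructor
    · intro h
      have hfst : m.fst.1 + α m.fst.2.1 + β m.fst.2.2 = 0 := congrArg RepModule.fst h
      have hsnd : m.snd = 0 := congrArg RepModule.snd h
      rw [add_assoc] at hfst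
      refine ⟨⟨(-m.fst.2, 0), 0⟩, ?_⟩
      ext <;> simp [standardMap, hsnd, eq_neg_of_add_eq_zero_left hfst, add_comm]
    · rintro ⟨n, rfl⟩
      ext <;> simp [standardMap]
  surjective m := ⟨⟨(m.fst, 0), m.snd⟩, by ext <;> simp⟩

section Criterion

variable {N : Type*} [AddCommGroup N] [Module (KroneckerAlgebra k) N] [Module k N]
  [IsScalarTower k (KroneckerAlgebra k) N]

theorem homEquiv_comp_standardMap_fst (α β : M₂ →ₗ[k] M₁)
    (g : ColumnModule k M₁ M₂ →ₗ[KroneckerAlgebra k] N) :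
    (ColumnModule.homEquiv (g ∘ₗ standardMap α β)).1 =
      ((ColumnModule.homEquiv g).1 ∘ₗ α - arrowMap₁ k N ∘ₗ (ColumnModule.homEquiv g).2).coprod
        ((ColumnModule.homEquiv g).1 ∘ₗ β - arrowMap₂ k N ∘ₗ (ColumnModule.homEquiv g).2) := by
  refine LinearMap.ext fun x => Subtype.ext ?_
  have hx : standardMap α β ⟨(x, 0), 0⟩ = (⟨(α x.1, 0), 0⟩ - arrow₁ k • ⟨0, x.1⟩) +
      (⟨(β x.2, 0), 0⟩ - arrow₂ k • ⟨0, x.2⟩) := by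
    simp only [sub_eq_add_neg]
    ext <;> simp [standardMap]
  refine (congrArg g hx).trans ?_
  rw [map_add, map_sub, map_sub, map_smul, map_smul]
  rfl

theorem bijective_comp_standardMap_iff (α β : M₂ →ₗ[k] M₁) :
    Function.Bijective (fun g : ColumnModule k M₁ M₂ →ₗ[KroneckerAlgebra k] N =>
        g ∘ₗ standardMap α β) ↔
      Function.Bijective fun g : (M₁ →ₗ[k] vertexSpace N (idem₁ k)) ×
          (M₂ →ₗ[k] vertexSpace N (idem₂ k)) =>
        (g.1 ∘ₗ α - arrowMap₁ k N ∘ₗ g.2, g.1 ∘ₗ β - arrowMap₂ k N ∘ₗ g.2) := by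
  let e := (ColumnModule.homEquiv (k := k) (C := M₂ × M₂) (E := PUnit.{u + 1}) (N := N)).trans
    (Equiv.prodUnique _ _)
  rw [← e.bijective.of_comp_iff', ← (LinearMap.coprodEquiv k).bijective.of_comp_iff',
    ← ColumnModule.homEquiv.bijective.of_comp_iff]
  exact iff_of_eq (congrArg _ (funext (homEquiv_comp_standardMap_fst α β)))

/-- The condition on the Schur complement of the identity for a block operator to be bijective. -/
theorem bijective_block_iff {A B C : Type*} [AddCommGroup A] [AddCommGroup B] [AddCommGroup C]
    (u : B →+ A) (w : A →+ C) (v : B →+ C) :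
    Function.Bijective (fun x : A × B => (x.1 - u x.2, w x.1 - v x.2)) ↔
      Function.Bijective (w.comp u - v) := by
  let shear : A × B ≃ A × B :=
    { toFun := fun x => (x.1 - u x.2, x.2)
      invFun := fun x => (x.1 + u x.2, x.2)
      left_inv := fun x => by simp
      right_inv := fun x => by simp }
  let shear' : A × C ≃ A × C :=
    { toFun := fun x => (x.1, w x.1 + x.2)
      invFun := fun x => (x.1, x.2 - w x.1)
      left_inv := fun x => by simp
      right_inv := fun x => by simp }
  have hfactor : (fun x : A × B => (x.1 - u x.2, w x.1 - v x.2)) =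
      shear' ∘ Prod.map id (w.comp u - v) ∘ shear := by
    ext x <;> simp [shear, shear']
  rw [hfactor, shear'.bijective.of_comp_iff', shear.bijective.of_comp_iff, Prod.map_bijective,
    and_iff_right Function.bijective_id]

theorem bijective_comp_standardMap_zero_id_iff :
    Function.Bijective (fun g : ColumnModule k k k →ₗ[KroneckerAlgebra k] N =>
        g ∘ₗ standardMap 0 LinearMap.id) ↔ Function.Bijective (arrowMap₁ k N) := by
  let a₁ := LinearMap.compRight k (M := k) (arrowMap₁ k N)
  let e₁ := LinearMap.ringLmapEquivSelf k k (vertexSpace N (idem₁ k))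
  let e₂ := LinearMap.ringLmapEquivSelf k k (vertexSpace N (idem₂ k))
  have hconj : arrowMap₁ k N ∘ e₂ = e₁ ∘ a₁ := rfl
  rw [bijective_comp_standardMap_iff, ← e₂.bijective.of_comp_iff, hconj, e₁.bijective.of_comp_iff',
    ← (Equiv.prodComm _ _).bijective.of_comp_iff', ← (Equiv.neg _).bijective.of_comp_iff' a₁]
  convert! bijective_block_iff (LinearMap.compRight k (M := k) (arrowMap₂ k N)).toAddMonoidHom 0
    a₁.toAddMonoidHom using 2
  · ext g <;> simp [a₁]
  · ext g; simp

/-- Once `α` is invertible on `N`, the module `V_p` sees only the polynomial `p` in `τ = α⁻¹β`. -/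
theorem bijective_comp_standardMap_id_root_iff (h : Function.Bijective (arrowMap₁ k N))
    {τ : Module.End k (vertexSpace N (idem₂ k))} (hτ : arrowMap₁ k N ∘ₗ τ = arrowMap₂ k N)
    {p : k[X]} (hp : p ≠ 0) :
    Function.Bijective (fun g : ColumnModule k (AdjoinRoot p) (AdjoinRoot p)
          →ₗ[KroneckerAlgebra k] N =>
        g ∘ₗ standardMap LinearMap.id (LinearMap.mulLeft k (AdjoinRoot.root p))) ↔
      Function.Bijective (aeval τ p) := by
  let a₁ := LinearMap.compRight k (M := AdjoinRoot p) (arrowMap₁ k N)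
  have ha₁ : Function.Bijective a₁ :=
    (LinearEquiv.congrRight (LinearEquiv.ofBijective _ h)).bijective
  rw [bijective_comp_standardMap_iff, ← bijective_sylvester_root_iff τ hp, ← ha₁.of_comp_iff']
  convert! bijective_block_iff a₁.toAddMonoidHom
    (LinearMap.lcomp k _ (LinearMap.mulLeft k (AdjoinRoot.root p))).toAddMonoidHom
    (LinearMap.compRight k (arrowMap₂ k N)).toAddMonoidHom using 2
  rw [← hτ]
  ext g x
  simp [a₁, sylvester_apply]

end Criterion

section Presentation

variable {N : Type u} [AddCommGroup N] [Module (KroneckerAlgebra k) N] [Module k N]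
  [IsScalarTower k (KroneckerAlgebra k) N]

theorem bijective_comp_simpleV_iff (F : FGProjPresentation (KroneckerAlgebra k) (simpleV k)) :
    Function.Bijective (fun g : F.Q →ₗ[KroneckerAlgebra k] N => g ∘ₗ F.map) ↔
      Function.Bijective (arrowMap₁ k N) :=
  F.bijective_comp_map_iff.trans <|
    (standardPresentation 0 LinearMap.id).bijective_comp_map_iff.symm.trans
      bijective_comp_standardMap_zero_id_iff

theorem bijective_comp_simpleVp_iff {p : k[X]} (hp : p ≠ 0)
    (F : FGProjPresentation (KroneckerAlgebra k) (simpleVp k p))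
    (h : Function.Bijective (arrowMap₁ k N))
    {τ : Module.End k (vertexSpace N (idem₂ k))} (hτ : arrowMap₁ k N ∘ₗ τ = arrowMap₂ k N) :
    Function.Bijective (fun g : F.Q →ₗ[KroneckerAlgebra k] N => g ∘ₗ F.map) ↔
      Function.Bijective (aeval τ p) :=
  have : Module.Finite k (AdjoinRoot p) := (AdjoinRoot.powerBasis hp).finite
  F.bijective_comp_map_iff.trans <|
    (standardPresentation _ _).bijective_comp_map_iff.symm.trans
      (bijective_comp_standardMap_id_root_iff h hτ hp)

end Presentation

/-! ### Rings over which the arrow `α` is invertible -/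

section ArrowInverse

variable {k : Type u} [Field k] {T : Type u} [Ring T] {θ : KroneckerAlgebra k →+* T} {s : T}

/-- `s` is a two-sided inverse of the arrow `α` in the Peirce decomposition of `T` that is given by
the images of the two idempotents. -/
structure IsArrowInverse (θ : KroneckerAlgebra k →+* T) (s : T) : Prop where
  arrow_mul : θ (arrow₁ k) * s = θ (idem₁ k)
  mul_arrow : s * θ (arrow₁ k) = θ (idem₂ k)
  idem_mul : θ (idem₂ k) * s = s
  mul_idem : s * θ (idem₁ k) = s

namespace IsArrowInverse

theorem map {T' : Type u} [Ring T'] (hs : IsArrowInverse θ s) (ψ : T →+* T') :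
    IsArrowInverse (ψ.comp θ) (ψ s) where
  arrow_mul := by simp only [RingHom.comp_apply, ← map_mul, hs.arrow_mul]
  mul_arrow := by simp only [RingHom.comp_apply, ← map_mul, hs.mul_arrow]
  idem_mul := by simp only [RingHom.comp_apply, ← map_mul, hs.idem_mul]
  mul_idem := by simp only [RingHom.comp_apply, ← map_mul, hs.mul_idem]

theorem unique {s' : T} (hs : IsArrowInverse θ s) (hs' : IsArrowInverse θ s') : s = s' := by
  rw [← hs.mul_idem, ← hs'.arrow_mul, ← mul_assoc, hs.mul_arrow, hs'.idem_mul]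

theorem mul_idem₂ (hs : IsArrowInverse θ s) : s * θ (idem₂ k) = 0 := by
  rw [← hs.mul_idem, mul_assoc, ← map_mul, idem₁_mul_idem₂, map_zero, mul_zero]

theorem idem₁_mul (hs : IsArrowInverse θ s) : θ (idem₁ k) * s = 0 := by
  rw [← hs.idem_mul, ← mul_assoc, ← map_mul, idem₁_mul_idem₂, map_zero, zero_mul]

theorem mul_self (hs : IsArrowInverse θ s) : s * s = 0 := by
  nth_rw 2 [← hs.idem_mul]
  rw [← mul_assoc, hs.mul_idem₂, zero_mul]

theorem commute (hs : IsArrowInverse θ s) {t : T} (h₁ : Commute t (θ (idem₁ k)))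
    (h₂ : Commute t (θ (idem₂ k))) (ha : Commute t (θ (arrow₁ k))) : Commute t s :=
  calc t * s = t * θ (idem₂ k) * s := by rw [mul_assoc, hs.idem_mul]
    _ = s * (θ (arrow₁ k) * t) * s := by rw [h₂.eq, ← hs.mul_arrow, mul_assoc s]
    _ = s * (t * θ (idem₁ k)) := by rw [← ha.eq, ← hs.arrow_mul]; simp only [mul_assoc]
    _ = s * t := by rw [h₁.eq, ← mul_assoc, hs.mul_idem]

end IsArrowInverse

/-- The element of `T` that acts as `α⁻¹β` on the second vertex and as `βα⁻¹` on the first one,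
when `s` is the inverse of `α`. -/
def loop (θ : KroneckerAlgebra k →+* T) (s : T) : T := θ (arrow₂ k) * s + s * θ (arrow₂ k)

namespace IsArrowInverse

theorem commute_loop_idem₁ (hs : IsArrowInverse θ s) : Commute (loop θ s) (θ (idem₁ k)) := by
  rw [Commute, SemiconjBy, loop, add_mul, mul_add, mul_assoc, hs.mul_idem, mul_assoc, ← map_mul,
    arrow₂_mul_idem₁, ← mul_assoc, ← map_mul, idem₁_mul_arrow₂, ← mul_assoc, hs.idem₁_mul]
  simp

theorem commute_loop_idem₂ (hs : IsArrowInverse θ s) : Commute (loop θ s) (θ (idem₂ k)) := by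
  rw [Commute, SemiconjBy, loop, add_mul, mul_add, mul_assoc, hs.mul_idem₂, mul_assoc, ← map_mul,
    arrow₂_mul_idem₂, ← mul_assoc, ← map_mul, idem₂_mul_arrow₂, ← mul_assoc, hs.idem_mul]
  simp

theorem loop_mul_arrow₁ (hs : IsArrowInverse θ s) : loop θ s * θ (arrow₁ k) = θ (arrow₂ k) := by
  rw [loop, add_mul, mul_assoc, hs.mul_arrow, mul_assoc, ← map_mul, ← map_mul, arrow₂_mul_idem₂,
    arrow₂_mul_arrow₁, map_zero, mul_zero, add_zero]

theorem arrow₁_mul_loop (hs : IsArrowInverse θ s) : θ (arrow₁ k) * loop θ s = θ (arrow₂ k) := by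
  rw [loop, mul_add, ← mul_assoc, ← mul_assoc, hs.arrow_mul, ← map_mul, ← map_mul,
    idem₁_mul_arrow₂, arrow₁_mul_arrow₂, map_zero, zero_mul, zero_add]

end IsArrowInverse

theorem commute_map_scalar (θ : KroneckerAlgebra k →+* T) (c : k) (r : KroneckerAlgebra k) :
    Commute (θ (scalar k c)) (θ r) :=
  have h : Commute (scalar k c) r := Algebra.commutes c r
  h.map θ

namespace IsArrowInverse

theorem commute_scalar_loop (hs : IsArrowInverse θ s) (c : k) :
    Commute (θ (scalar k c)) (loop θ s) :=
  have hcs := hs.commute (commute_map_scalar θ c _) (commute_map_scalar θ c _)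
    (commute_map_scalar θ c _)
  ((commute_map_scalar θ c _).mul_right hcs).add_right (hcs.mul_right (commute_map_scalar θ c _))

/-- Evaluation of polynomials at `loop θ s`, with coefficients acting through `θ`. -/
noncomputable def evalLoop (hs : IsArrowInverse θ s) : k[X] →+* T :=
  eval₂RingHom' (θ.comp (scalar k)) (loop θ s) hs.commute_scalar_loop

theorem evalLoop_X (hs : IsArrowInverse θ s) : hs.evalLoop X = loop θ s := eval₂_X _ _

theorem evalLoop_C (hs : IsArrowInverse θ s) (c : k) : hs.evalLoop (C c) = θ (scalar k c) :=
  eval₂_C _ _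

theorem commute_evalLoop (hs : IsArrowInverse θ s) {r : KroneckerAlgebra k}
    (hr : Commute (loop θ s) (θ r)) (f : k[X]) : Commute (hs.evalLoop f) (θ r) := by
  induction f using Polynomial.induction_on' with
  | add f g hf hg => rw [map_add]; exact hf.add_left hg
  | monomial n c =>
    rw [← C_mul_X_pow_eq_monomial, map_mul, map_pow, evalLoop_C, evalLoop_X]
    exact (commute_map_scalar θ c r).mul_left (hr.pow_left n)

theorem commute_evalLoop_idem₁ (hs : IsArrowInverse θ s) (f : k[X]) :
    Commute (hs.evalLoop f) (θ (idem₁ k)) :=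
  hs.commute_evalLoop hs.commute_loop_idem₁ f

theorem commute_evalLoop_idem₂ (hs : IsArrowInverse θ s) (f : k[X]) :
    Commute (hs.evalLoop f) (θ (idem₂ k)) :=
  hs.commute_evalLoop hs.commute_loop_idem₂ f

theorem commute_evalLoop_arrow₁ (hs : IsArrowInverse θ s) (f : k[X]) :
    Commute (hs.evalLoop f) (θ (arrow₁ k)) :=
  hs.commute_evalLoop (hs.loop_mul_arrow₁.trans hs.arrow₁_mul_loop.symm) f

theorem commute_evalLoop_inverse (hs : IsArrowInverse θ s) (f : k[X]) :
    Commute (hs.evalLoop f) s :=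
  hs.commute (hs.commute_evalLoop_idem₁ f) (hs.commute_evalLoop_idem₂ f)
    (hs.commute_evalLoop_arrow₁ f)

end IsArrowInverse

end ArrowInverse

section Inverting

variable {k : Type u} [Field k] {T : Type u} [Ring T] {θ : KroneckerAlgebra k →+* T} {s : T}
variable {N : Type*} [AddCommGroup N] [Module (KroneckerAlgebra k) N] [Module k N]
  [IsScalarTower k (KroneckerAlgebra k) N] [Module T N]

namespace IsArrowInverse

theorem bijective_arrowMap₁ (hs : IsArrowInverse θ s)
    (hN : ∀ (r : KroneckerAlgebra k) (n : N), θ r • n = r • n) :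
    Function.Bijective (arrowMap₁ k N) := by
  refine Function.bijective_iff_has_inverse.2 ⟨fun n => ⟨s • (n : N), ?_⟩, fun n => ?_, fun n => ?_⟩
  · rw [mem_vertexSpace, ← hN, smul_smul, hs.idem_mul]
  · refine Subtype.ext ?_
    simp only [coe_arrowMap₁, ← hN, smul_smul, hs.mul_arrow]
    exact (hN _ _).trans n.2
  · refine Subtype.ext ?_
    simp only [coe_arrowMap₁, ← hN, smul_smul, hs.arrow_mul]
    exact (hN _ _).trans n.2

theorem evalLoop_smul (hs : IsArrowInverse θ s)
    (hN : ∀ (r : KroneckerAlgebra k) (n : N), θ r • n = r • n)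
    {τ : Module.End k (vertexSpace N (idem₂ k))} (hτ : arrowMap₁ k N ∘ₗ τ = arrowMap₂ k N)
    (f : k[X]) (n : vertexSpace N (idem₂ k)) :
    hs.evalLoop f • (n : N) = (aeval τ f n : vertexSpace N (idem₂ k)) := by
  have hidem (n : vertexSpace N (idem₂ k)) : θ (idem₂ k) • (n : N) = n := (hN _ _).trans n.2
  have hloop (n : vertexSpace N (idem₂ k)) : loop θ s • (n : N) = τ n := by
    have hn : θ (arrow₁ k) • (τ n : N) = θ (arrow₂ k) • (n : N) := by
      rw [hN, hN]
      exact congrArg Subtype.val (LinearMap.congr_fun hτ n)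
    have hs0 : s • (n : N) = 0 := by rw [← hidem, smul_smul, hs.mul_idem₂, zero_smul]
    rw [loop, add_smul, mul_smul, mul_smul, hs0, smul_zero, zero_add, ← hn, smul_smul,
      hs.mul_arrow, hidem]
  induction f using Polynomial.induction_on with
  | C c => rw [evalLoop_C, aeval_C, hN]; exact algebraMap_smul (KroneckerAlgebra k) c (n : N)
  | add f g hf hg => rw [map_add, add_smul, hf, hg, map_add]; rfl
  | monomial d c ih =>
    rw [pow_succ', mul_left_comm, map_mul, mul_smul, ih, evalLoop_X, hloop, map_mul (aeval τ) X,
      aeval_X]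
    rfl

/-- Multiplication by `α⁻¹` on the first vertex space identifies `N` with two copies of the second
vertex space. -/
def equivProd (hs : IsArrowInverse θ s)
    (hN : ∀ (r : KroneckerAlgebra k) (n : N), θ r • n = r • n) :
    N ≃ vertexSpace N (idem₂ k) × vertexSpace N (idem₂ k) where
  toFun n := (⟨s • n, by rw [mem_vertexSpace, ← hN, smul_smul, hs.idem_mul]⟩,
    ⟨θ (idem₂ k) • n, by rw [mem_vertexSpace, ← hN, smul_smul, ← map_mul, idem₂_mul_idem₂]⟩)
  invFun x := θ (arrow₁ k) • (x.1 : N) + x.2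
  left_inv n := by
    dsimp only
    rw [smul_smul, hs.arrow_mul, ← add_smul, ← map_add, idem₁_add_idem₂, map_one, one_smul]
  right_inv := by
    rintro ⟨⟨x, hx⟩, ⟨y, hy⟩⟩
    rw [mem_vertexSpace, ← hN] at hx hy
    have hsy : s • y = 0 := by rw [← hy, smul_smul, hs.mul_idem₂, zero_smul]
    ext
    · simp only [smul_add, smul_smul, hs.mul_arrow, hx, hsy, add_zero]
    · simp only [smul_add, smul_smul, ← map_mul, idem₂_mul_arrow₁, map_zero, zero_smul, hy,
        zero_add]

theorem bijective_evalLoop_smul_iff (hs : IsArrowInverse θ s)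
    (hN : ∀ (r : KroneckerAlgebra k) (n : N), θ r • n = r • n)
    {τ : Module.End k (vertexSpace N (idem₂ k))} (hτ : arrowMap₁ k N ∘ₗ τ = arrowMap₂ k N)
    (f : k[X]) :
    Function.Bijective (fun n : N => hs.evalLoop f • n) ↔ Function.Bijective (aeval τ f) := by
  have hconj : hs.equivProd hN ∘ (fun n : N => hs.evalLoop f • n) =
      Prod.map (aeval τ f) (aeval τ f) ∘ hs.equivProd hN := by
    ext n
    · exact (smul_smul _ _ _).trans <| ((hs.commute_evalLoop_inverse f).eq ▸ mul_smul _ _ n).trans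
        (hs.evalLoop_smul hN hτ f (hs.equivProd hN n).1)
    · exact (smul_smul _ _ _).trans <| ((hs.commute_evalLoop_idem₂ f).eq ▸ mul_smul _ _ n).trans
        (hs.evalLoop_smul hN hτ f (hs.equivProd hN n).2)
  rw [← (hs.equivProd hN).bijective.of_comp_iff', hconj, (hs.equivProd hN).bijective.of_comp_iff,
    Prod.map_bijective, and_self_iff]

end IsArrowInverse

end Inverting

section Criterion

variable {k : Type u} [Field k] {T : Type u} [Ring T] {θ : KroneckerAlgebra k →+* T} {s : T}

theorem exists_isArrowInverse [Module (KroneckerAlgebra k) T] [Module k T]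
    [IsScalarTower k (KroneckerAlgebra k) T]
    (hT : ∀ (r : KroneckerAlgebra k) (t : T), θ r • t = r • t)
    (h : Function.Bijective (arrowMap₁ k T)) : ∃ s, IsArrowInverse θ s := by
  have cancel {x y : T} (hx : θ (idem₂ k) * x = x) (hy : θ (idem₂ k) * y = y)
      (hxy : θ (arrow₁ k) * x = θ (arrow₁ k) * y) : x = y :=
    congrArg Subtype.val <| h.1
      (a₁ := ⟨x, (hT _ x).symm.trans hx⟩) (a₂ := ⟨y, (hT _ y).symm.trans hy⟩)
      (Subtype.ext ((hT _ x).symm.trans (hxy.trans (hT _ y))))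
  obtain ⟨⟨s, hs⟩, hs'⟩ := h.2 ⟨θ (idem₁ k), by
    rw [mem_vertexSpace, ← hT, smul_eq_mul, ← map_mul, idem₁_mul_idem₁]⟩
  have arrow_mul : θ (arrow₁ k) * s = θ (idem₁ k) :=
    (hT _ s).trans (congrArg Subtype.val hs')
  have idem_mul : θ (idem₂ k) * s = s := (hT _ s).trans hs
  refine ⟨s, arrow_mul, cancel ?_ ?_ ?_, idem_mul, cancel ?_ idem_mul ?_⟩
  · rw [← mul_assoc, idem_mul]
  · rw [← map_mul, idem₂_mul_idem₂]
  · rw [← mul_assoc, arrow_mul, ← map_mul, ← map_mul, idem₁_mul_arrow₁, arrow₁_mul_idem₂]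
  · rw [← mul_assoc, idem_mul]
  · rw [← mul_assoc, arrow_mul, ← map_mul, idem₁_mul_idem₁]

theorem bijective_extendedMap_simpleV_iff
    (F : FGProjPresentation (KroneckerAlgebra k) (simpleV k)) :
    Function.Bijective (extendedMap θ F.map) ↔ ∃ s, IsArrowInverse θ s := by
  rw [bijective_extendedMap_iff]
  refine ⟨fun H => ?_, fun ⟨s, hs⟩ N _ _ _ hN => ?_⟩
  · let _ : Module (KroneckerAlgebra k) T := Module.compHom T θ
    let _ : Module k T := Module.compHom T (scalar k)
    have : IsScalarTower k (KroneckerAlgebra k) T :=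
      IsScalarTower.of_algebraMap_smul fun _ _ => rfl
    exact exists_isArrowInverse (fun _ _ => rfl)
      ((bijective_comp_simpleV_iff F).1 (H T fun _ _ => rfl))
  · let _ : Module k N := Module.compHom N (scalar k)
    have : IsScalarTower k (KroneckerAlgebra k) N :=
      IsScalarTower.of_algebraMap_smul fun _ _ => rfl
    exact (bijective_comp_simpleV_iff F).2 (hs.bijective_arrowMap₁ hN)

theorem bijective_extendedMap_simpleVp_iff (hs : IsArrowInverse θ s) {p : k[X]} (hp : p ≠ 0)
    (F : FGProjPresentation (KroneckerAlgebra k) (simpleVp k p)) :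
    Function.Bijective (extendedMap θ F.map) ↔ IsUnit (hs.evalLoop p) := by
  have key (N : Type u) [AddCommGroup N] [Module (KroneckerAlgebra k) N] [Module T N]
      (hN : ∀ (r : KroneckerAlgebra k) (n : N), θ r • n = r • n) :
      Function.Bijective (fun g : F.Q →ₗ[KroneckerAlgebra k] N => g ∘ₗ F.map) ↔
        Function.Bijective fun n : N => hs.evalLoop p • n := by
    let _ : Module k N := Module.compHom N (scalar k)
    have : IsScalarTower k (KroneckerAlgebra k) N :=
      IsScalarTower.of_algebraMap_smul fun _ _ => rfl
    have h := hs.bijective_arrowMap₁ hN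
    have hτ : arrowMap₁ k N ∘ₗ (LinearEquiv.ofBijective _ h).symm ∘ₗ arrowMap₂ k N =
        arrowMap₂ k N := by
      ext n; simp [-coe_arrowMap₁]
    exact (bijective_comp_simpleVp_iff hp F h hτ).trans
      (hs.bijective_evalLoop_smul_iff hN hτ p).symm
  rw [bijective_extendedMap_iff]
  refine ⟨fun H => ?_, fun hu N _ _ _ hN => (key N hN).2 hu.smul_bijective⟩
  let _ : Module (KroneckerAlgebra k) T := Module.compHom T θ
  exact IsUnit.isUnit_iff_mulLeft_bijective.2 ((key T fun _ _ => rfl).1 (H T fun _ _ => rfl))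

variable {Δ : Set k[X]}

theorem isInverting_iff (hΔ : ∀ p ∈ Δ, p ≠ 0)
    (f : ∀ U : localizingSet k Δ, FGProjPresentation (KroneckerAlgebra k) U.1) :
    IsInverting (Set.range fun U => (f U).toFGProjMap) θ ↔
      ∃ (s : T) (hs : IsArrowInverse θ s), ∀ p ∈ Δ, IsUnit (hs.evalLoop p) := by
  have hV := bijective_extendedMap_simpleV_iff (θ := θ) (f ⟨simpleV k, Or.inl rfl⟩)
  have hVp (p : k[X]) (hp : p ∈ Δ) {s : T} (hs : IsArrowInverse θ s) :=
    bijective_extendedMap_simpleVp_iff hs (hΔ p hp) (f ⟨simpleVp k p, Or.inr ⟨p, hp, rfl⟩⟩)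
  constructor
  · intro H
    obtain ⟨s, hs⟩ := hV.1 (H _ ⟨_, rfl⟩)
    exact ⟨s, hs, fun p hp => (hVp p hp hs).1 (H _ ⟨_, rfl⟩)⟩
  · rintro ⟨s, hs, h⟩ _ ⟨⟨U, rfl | ⟨p, hp, rfl⟩⟩, rfl⟩
    · exact hV.2 ⟨s, hs⟩
    · exact (hVp p hp hs).2 (h p hp)

theorem nonempty_presentation (hΔ : ∀ p ∈ Δ, p ≠ 0) (U : localizingSet k Δ) :
    Nonempty (FGProjPresentation (KroneckerAlgebra k) U.1) := by
  obtain ⟨U, rfl | ⟨p, hp, rfl⟩⟩ := U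
  · exact ⟨standardPresentation (0 : k →ₗ[k] k) LinearMap.id⟩
  · have : Module.Finite k (AdjoinRoot p) := (AdjoinRoot.powerBasis (hΔ p hp)).finite
    exact ⟨standardPresentation LinearMap.id (LinearMap.mulLeft k (AdjoinRoot.root p))⟩

end Criterion

end KroneckerAlgebra

/-! ### Homomorphisms from matrix rings -/

section MatrixUnits

variable {n T D : Type*} [Fintype n] [DecidableEq n] [Semiring T] [Semiring D]

/-- The entries of `E` form a complete system of matrix units in `T`. -/
structure IsMatrixUnits (E : Matrix n n T) : Prop where
  mul (i j k l : n) : E i j * E k l = if j = k then E i l else 0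
  sum_diag : ∑ i, E i i = 1

/-- The homomorphism `Mₙ(D) → T` given by a system of matrix units in `T` and a homomorphism
`D → T` into its centralizer. -/
def matrixLift {E : Matrix n n T} (hE : IsMatrixUnits E) (ρ : D →+* T)
    (hρ : ∀ d i j, Commute (ρ d) (E i j)) : Matrix n n D →+* T where
  toFun m := ∑ i, ∑ j, ρ (m i j) * E i j
  map_zero' := by simp
  map_one' := by simp [Matrix.one_apply, apply_ite ρ, ite_mul, hE.sum_diag]
  map_add' m m' := by simp [add_mul, Finset.sum_add_distrib]
  map_mul' m m' := by
    have hmul (i j k l : n) : ρ (m i j) * E i j * (ρ (m' k l) * E k l) =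
        if j = k then ρ (m i j * m' k l) * E i l else 0 := by
      rw [mul_assoc, ← mul_assoc (E i j), ← (hρ _ i j).eq, mul_assoc (ρ _) (E i j), hE.mul,
        map_mul, mul_assoc]
      split_ifs <;> simp
    rw [Finset.sum_mul]
    refine Finset.sum_congr rfl fun i _ => ?_
    simp only [Matrix.mul_apply, map_sum, Finset.sum_mul (ι := n)]
    rw [Finset.sum_comm]
    refine Finset.sum_congr rfl fun j _ => ?_
    simp only [Finset.mul_sum, hmul]
    rw [Finset.sum_comm]
    simp

theorem matrixRingHom_ext {ψ ψ' : Matrix n n D →+* T}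
    (hscalar : ψ.comp (Matrix.scalar n) = ψ'.comp (Matrix.scalar n))
    (hsingle : ∀ i j, ψ (Matrix.single i j 1) = ψ' (Matrix.single i j 1)) : ψ = ψ' := by
  ext m
  have hm : m = ∑ i, ∑ j, Matrix.scalar n (m i j) * Matrix.single i j 1 := by
    conv_lhs => rw [Matrix.matrix_eq_sum_single m]
    simp [← Matrix.smul_eq_diagonal_mul]
  rw [hm]
  simp only [map_sum, map_mul, hsingle]
  simp only [← RingHom.comp_apply, hscalar]

end MatrixUnits

/-! ### The ring `D` as a localization of `k[X]` -/

section NoncommutativeLift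

variable {A B T : Type*} [CommRing A] [CommRing B] [Algebra A B] [Ring T]

theorem exists_ringHom_comp_algebraMap_eq (M : Submonoid A) [IsLocalization M B] (f : A →+* T)
    (hf : ∀ m ∈ M, IsUnit (f m)) : ∃ ρ : B →+* T, ρ.comp (algebraMap A B) = f := by
  let fM : M →* Tˣ := IsUnit.liftRight ((f : A →* T).comp M.subtype) fun m => hf m m.2
  let l : Localization M →+* T := OreLocalization.universalHom f fM fun _ => rfl
  refine ⟨l.comp (IsLocalization.algEquiv M B (Localization M) : B →+* Localization M),
    RingHom.ext fun a => ?_⟩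
  have : IsLocalization.algEquiv M B (Localization M) (algebraMap A B a) =
      algebraMap A (Localization M) a := AlgEquiv.commutes _ a
  exact (congrArg l this).trans (OreLocalization.universalHom_commutes f fM fun _ => rfl)

theorem commute_of_commute_algebraMap (M : Submonoid A) [IsLocalization M B] (ρ : B →+* T) {t : T}
    (ht : ∀ a, Commute (ρ (algebraMap A B a)) t) (b : B) : Commute (ρ b) t := by
  obtain ⟨⟨a, m⟩, h⟩ := IsLocalization.surj M b
  obtain ⟨v, hv⟩ := (IsLocalization.map_units B m).map ρ
  have hb : ρ b = ρ (algebraMap A B a) * ↑v⁻¹ := by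
    rw [Units.eq_mul_inv_iff_mul_eq, hv, ← map_mul, h]
  have hm : Commute ↑v t := hv ▸ ht m
  rw [hb]
  exact (ht a).mul_left hm.units_inv_left

end NoncommutativeLift

namespace KroneckerAlgebra

section InvertedSubring

variable {k : Type u} [Field k] {Δ : Set k[X]}

theorem algebraMap_mem_invertedSubring (f : k[X]) :
    algebraMap k[X] (RatFunc k) f ∈ invertedSubring k Δ :=
  Subring.subset_closure (Or.inl ⟨f, rfl⟩)

noncomputable instance : Algebra k[X] (invertedSubring k Δ) :=
  ((algebraMap k[X] (RatFunc k)).codRestrict _ algebraMap_mem_invertedSubring).toAlgebra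

theorem closure_le_nonZeroDivisors (hΔ : ∀ p ∈ Δ, p ≠ 0) :
    Submonoid.closure Δ ≤ nonZeroDivisors k[X] :=
  Submonoid.closure_le.2 fun p hp => mem_nonZeroDivisors_of_ne_zero (hΔ p hp)

theorem isUnit_algebraMap_invertedSubring {p : k[X]} (hp : p ∈ Δ) (hp0 : p ≠ 0) :
    IsUnit (algebraMap k[X] (invertedSubring k Δ) p) :=
  IsUnit.of_mul_eq_one
    ⟨1 / algebraMap k[X] (RatFunc k) p, Subring.subset_closure (Or.inr ⟨p, hp, rfl⟩)⟩
    (Subtype.ext (mul_one_div_cancel (RatFunc.algebraMap_ne_zero hp0)))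

theorem isUnit_of_mem_closure {T : Type*} [Ring T] (f : k[X] →+* T)
    (hf : ∀ p ∈ Δ, IsUnit (f p)) {m : k[X]} (hm : m ∈ Submonoid.closure Δ) : IsUnit (f m) :=
  (Submonoid.closure_le.2 hf : _ ≤ (IsUnit.submonoid T).comap f) hm

theorem isLocalization_invertedSubring (hΔ : ∀ p ∈ Δ, p ≠ 0) :
    IsLocalization (Submonoid.closure Δ) (invertedSubring k Δ) := by
  have hM := closure_le_nonZeroDivisors hΔ
  have hle : invertedSubring k Δ ≤
      (Localization.subalgebra.ofField (RatFunc k) (Submonoid.closure Δ) hM).toSubring := by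
    refine Subring.closure_le.2 (Set.union_subset ?_ ?_)
    · rintro _ ⟨f, rfl⟩
      exact ⟨f, 1, one_mem _, by simp⟩
    · rintro _ ⟨p, hp, rfl⟩
      exact ⟨1, p, Submonoid.subset_closure hp, by simp⟩
  refine ⟨fun m => ?_, ?_, fun h => ?_⟩
  · exact isUnit_of_mem_closure _ (fun p hp => isUnit_algebraMap_invertedSubring hp (hΔ p hp)) m.2
  · rintro ⟨z, hz⟩
    obtain ⟨a, s, hs, rfl⟩ := hle hz
    exact ⟨⟨a, s, hs⟩, Subtype.ext <| inv_mul_cancel_right₀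
      (RatFunc.algebraMap_ne_zero (nonZeroDivisors.ne_zero (hM hs))) _⟩
  · exact ⟨1, by rw [RatFunc.algebraMap_injective k (congrArg Subtype.val h)]⟩

theorem isDedekindDomain_invertedSubring (hΔ : ∀ p ∈ Δ, p ≠ 0) :
    IsDedekindDomain (invertedSubring k Δ) :=
  have := isLocalization_invertedSubring hΔ
  IsLocalization.isDedekindDomain k[X] (closure_le_nonZeroDivisors hΔ) _

end InvertedSubring
end KroneckerAlgebra

/-! ### The universal localization -/

theorem IsUniversalLocalization.nonempty_ringEquiv {R S S' : Type u} [Ring R] [Ring S] [Ring S']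
    {Sig : Set (FGProjMap R)} {φ : R →+* S} {φ' : R →+* S'}
    (h : IsUniversalLocalization Sig φ) (h' : IsUniversalLocalization Sig φ') :
    Nonempty (S ≃+* S') := by
  obtain ⟨f, hf, -⟩ := h.universal S' φ' h'.inverting
  obtain ⟨g, hg, -⟩ := h'.universal S φ h.inverting
  refine ⟨RingEquiv.ofRingHom f g ?_ ?_⟩
  · refine (h'.universal S' φ' h'.inverting).unique ?_ (RingHom.id_comp φ')
    rw [RingHom.comp_assoc, hg, hf]
  · refine (h.universal S φ h.inverting).unique ?_ (RingHom.id_comp φ)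
    rw [RingHom.comp_assoc, hf, hg]

namespace KroneckerAlgebra

variable {k : Type u} [Field k] {Δ : Set k[X]} {T : Type u} [Ring T]
variable {θ : KroneckerAlgebra k →+* T} {s : T}

variable (k Δ) in
/-- The homomorphism `R → M₂(D)` that maps the arrows `α` and `β` to `E₁₂` and `x E₁₂`. -/
noncomputable def toMatrix :
    KroneckerAlgebra k →+* Matrix (Fin 2) (Fin 2) (invertedSubring k Δ) where
  toFun r :=
    !![algebraMap k[X] _ (C r.a), algebraMap k[X] _ (C r.v.1 + C r.v.2 * X);
      0, algebraMap k[X] _ (C r.b)]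
  map_one' := by ext i j; fin_cases i <;> fin_cases j <;> simp
  map_zero' := by ext i j; fin_cases i <;> fin_cases j <;> simp
  map_mul' r s := by
    simp only [mul_a, mul_v, mul_b, Matrix.mul_fin_two]
    congr 1
    simp only [Prod.fst_add, Prod.smul_fst, Prod.snd_add, Prod.smul_snd, smul_eq_mul, map_add,
      map_mul, mul_zero, zero_mul, add_zero, zero_add]
    congr! 3
    ring
  map_add' r s := by
    ext i j; fin_cases i <;> fin_cases j <;> simp [add_mul, add_add_add_comm]

theorem toMatrix_apply (r : KroneckerAlgebra k) :
    toMatrix k Δ r = !![algebraMap k[X] _ (C r.a), algebraMap k[X] _ (C r.v.1 + C r.v.2 * X);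
      0, algebraMap k[X] _ (C r.b)] := rfl

theorem toMatrix_idem₁ : toMatrix k Δ (idem₁ k) = Matrix.single 0 0 1 := by
  ext i j; fin_cases i <;> fin_cases j <;> simp [toMatrix_apply]

theorem toMatrix_idem₂ : toMatrix k Δ (idem₂ k) = Matrix.single 1 1 1 := by
  ext i j; fin_cases i <;> fin_cases j <;> simp [toMatrix_apply]

theorem toMatrix_arrow₁ : toMatrix k Δ (arrow₁ k) = Matrix.single 0 1 1 := by
  ext i j; fin_cases i <;> fin_cases j <;> simp [toMatrix_apply]

theorem toMatrix_arrow₂ :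
    toMatrix k Δ (arrow₂ k) = Matrix.single 0 1 (algebraMap k[X] _ X) := by
  ext i j; fin_cases i <;> fin_cases j <;> simp [toMatrix_apply]

theorem toMatrix_scalar (c : k) :
    toMatrix k Δ (scalar k c) = Matrix.scalar (Fin 2) (algebraMap k[X] _ (C c)) := by
  ext i j; fin_cases i <;> fin_cases j <;> simp [toMatrix_apply]

theorem isArrowInverse_toMatrix : IsArrowInverse (toMatrix k Δ) (Matrix.single 1 0 1) where
  arrow_mul := by simp [toMatrix_arrow₁, toMatrix_idem₁]
  mul_arrow := by simp [toMatrix_arrow₁, toMatrix_idem₂]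
  idem_mul := by simp [toMatrix_idem₂]
  mul_idem := by simp [toMatrix_idem₁]

theorem loop_toMatrix : loop (toMatrix k Δ) (Matrix.single 1 0 1) =
    Matrix.scalar (Fin 2) (algebraMap k[X] _ X) := by
  rw [loop, toMatrix_arrow₂]
  ext i j; fin_cases i <;> fin_cases j <;> simp

theorem evalLoop_toMatrix :
    (isArrowInverse_toMatrix (k := k) (Δ := Δ)).evalLoop =
      (Matrix.scalar (Fin 2)).comp (algebraMap k[X] (invertedSubring k Δ)) := by
  refine Polynomial.ringHom_ext (fun c => ?_) ?_
  · rw [IsArrowInverse.evalLoop_C, toMatrix_scalar]; rfl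
  · rw [IsArrowInverse.evalLoop_X, loop_toMatrix]; rfl

theorem eq_of_comp_toMatrix_eq (hΔ : ∀ p ∈ Δ, p ≠ 0)
    {ψ ψ' : Matrix (Fin 2) (Fin 2) (invertedSubring k Δ) →+* T}
    (h : ψ.comp (toMatrix k Δ) = ψ'.comp (toMatrix k Δ)) : ψ = ψ' := by
  have := isLocalization_invertedSubring hΔ
  have hmap (r : KroneckerAlgebra k) : ψ (toMatrix k Δ r) = ψ' (toMatrix k Δ r) :=
    RingHom.congr_fun h r
  have hinv : ψ (Matrix.single 1 0 1) = ψ' (Matrix.single 1 0 1) :=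
    (isArrowInverse_toMatrix.map ψ).unique (h ▸ isArrowInverse_toMatrix.map ψ')
  refine matrixRingHom_ext (IsLocalization.ringHom_ext (Submonoid.closure Δ)
    (Polynomial.ringHom_ext (fun c => ?_) ?_)) fun i j => ?_
  · simp only [RingHom.comp_apply, ← toMatrix_scalar, hmap]
  · simp only [RingHom.comp_apply, ← loop_toMatrix, loop, map_add, map_mul, hmap, hinv]
  · fin_cases i <;> fin_cases j
    · exact toMatrix_idem₁ (k := k) (Δ := Δ) ▸ hmap _
    · exact toMatrix_arrow₁ (k := k) (Δ := Δ) ▸ hmap _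
    · exact hinv
    · exact toMatrix_idem₂ (k := k) (Δ := Δ) ▸ hmap _

theorem IsArrowInverse.isMatrixUnits (hs : IsArrowInverse θ s) :
    IsMatrixUnits !![θ (idem₁ k), θ (arrow₁ k); s, θ (idem₂ k)] where
  mul i j l m := by
    fin_cases i <;> fin_cases j <;> fin_cases l <;> fin_cases m <;>
      simp [hs.arrow_mul, hs.mul_arrow, hs.idem_mul, hs.mul_idem, hs.mul_idem₂, hs.idem₁_mul,
        hs.mul_self, ← map_mul, idem₁_mul_idem₁, idem₁_mul_idem₂, idem₂_mul_idem₁,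
        idem₂_mul_idem₂, idem₁_mul_arrow₁, arrow₁_mul_idem₂, arrow₁_mul_idem₁, arrow₁_mul_arrow₁,
        idem₂_mul_arrow₁]
  sum_diag := by simp [← map_add, idem₁_add_idem₂]

theorem IsArrowInverse.commute_evalLoop_matrixUnits (hs : IsArrowInverse θ s) (f : k[X])
    (i j : Fin 2) :
    Commute (hs.evalLoop f) (!![θ (idem₁ k), θ (arrow₁ k); s, θ (idem₂ k)] i j) := by
  fin_cases i <;> fin_cases j
  exacts [hs.commute_evalLoop_idem₁ f, hs.commute_evalLoop_arrow₁ f,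
    hs.commute_evalLoop_inverse f, hs.commute_evalLoop_idem₂ f]

theorem exists_comp_toMatrix_eq (hΔ : ∀ p ∈ Δ, p ≠ 0) (hs : IsArrowInverse θ s)
    (hu : ∀ p ∈ Δ, IsUnit (hs.evalLoop p)) :
    ∃ ψ : Matrix (Fin 2) (Fin 2) (invertedSubring k Δ) →+* T, ψ.comp (toMatrix k Δ) = θ := by
  have := isLocalization_invertedSubring hΔ
  obtain ⟨ρ, hρ⟩ := exists_ringHom_comp_algebraMap_eq (B := invertedSubring k Δ)
    (Submonoid.closure Δ) hs.evalLoop fun _ => isUnit_of_mem_closure hs.evalLoop hu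
  have hρf (f : k[X]) : ρ (algebraMap k[X] _ f) = hs.evalLoop f := RingHom.congr_fun hρ f
  have hcomm (d : invertedSubring k Δ) (i j : Fin 2) :=
    commute_of_commute_algebraMap (Submonoid.closure Δ) ρ
      (fun f => (hρf f).symm ▸ hs.commute_evalLoop_matrixUnits f i j) d
  refine ⟨matrixLift hs.isMatrixUnits ρ hcomm, RingHom.ext fun r => ?_⟩
  have hr : r = scalar k r.a * idem₁ k + scalar k r.v.1 * arrow₁ k + scalar k r.v.2 * arrow₂ k
      + scalar k r.b * idem₂ k := by
    ext <;> simp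
  conv_rhs => rw [hr]
  simp [matrixLift, toMatrix_apply, Fin.sum_univ_two, hρf, hs.evalLoop_C, hs.evalLoop_X,
    add_mul, mul_assoc, hs.loop_mul_arrow₁, add_assoc]

theorem isUniversalLocalization_toMatrix (hΔ : ∀ p ∈ Δ, p ≠ 0)
    (f : ∀ U : localizingSet k Δ, FGProjPresentation (KroneckerAlgebra k) U.1) :
    IsUniversalLocalization (Set.range fun U => (f U).toFGProjMap) (toMatrix k Δ) where
  inverting := by
    refine (isInverting_iff hΔ f).2 ⟨_, isArrowInverse_toMatrix, fun p hp => ?_⟩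
    rw [evalLoop_toMatrix]
    exact (isUnit_algebraMap_invertedSubring hp (hΔ p hp)).map (Matrix.scalar (Fin 2))
  universal T _ θ hθ := by
    obtain ⟨s, hs, hu⟩ := (isInverting_iff hΔ f).1 hθ
    obtain ⟨ψ, hψ⟩ := exists_comp_toMatrix_eq hΔ hs hu
    exact ⟨ψ, hψ, fun ψ' hψ' => eq_of_comp_toMatrix_eq hΔ (hψ'.trans hψ.symm)⟩

end KroneckerAlgebra

theorem lemma4p6_general (k : Type u) [Field k] (Δ : Set k[X]) (hΔ : ∀ p ∈ Δ, p ≠ 0) :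
    (∃ φ : KroneckerAlgebra k →+* Matrix (Fin 2) (Fin 2) (KroneckerAlgebra.invertedSubring k Δ),
      IsUniversalLocalizationAt (KroneckerAlgebra.localizingSet k Δ) φ) ∧
    (∀ (S : Type u) [Ring S] (φ : KroneckerAlgebra k →+* S),
      IsUniversalLocalizationAt (KroneckerAlgebra.localizingSet k Δ) φ →
        Nonempty (S ≃+* Matrix (Fin 2) (Fin 2) (KroneckerAlgebra.invertedSubring k Δ)) ∧
        IsMoritaEquivalent ℤ S (KroneckerAlgebra.invertedSubring k Δ)) ∧
    IsDedekindDomain (KroneckerAlgebra.invertedSubring k Δ) := by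
  have huniv := KroneckerAlgebra.isUniversalLocalization_toMatrix hΔ
  refine ⟨⟨KroneckerAlgebra.toMatrix k Δ,
      fun U => (KroneckerAlgebra.nonempty_presentation hΔ U).some, huniv _⟩, ?_,
    KroneckerAlgebra.isDedekindDomain_invertedSubring hΔ⟩
  rintro S _ φ ⟨f, hf⟩
  obtain ⟨e⟩ := hf.nonempty_ringEquiv (huniv f)
  exact ⟨⟨e⟩, (IsMoritaEquivalent.of_algEquiv ℤ (AlgEquiv.ofRingEquiv (f := e) (by simp))).trans ℤ
    (IsMoritaEquivalent.matrix _ (ι := Fin 2) ℤ).symm⟩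

theorem lemma4p6 (k : Type u) [Field k] (Δ : Set k[X])
    (hΔ : ∀ p ∈ Δ, p.Monic ∧ Irreducible p) :
    (∃ φ : KroneckerAlgebra k →+* Matrix (Fin 2) (Fin 2) (KroneckerAlgebra.invertedSubring k Δ),
      IsUniversalLocalizationAt (KroneckerAlgebra.localizingSet k Δ) φ) ∧
    (∀ (S : Type u) [Ring S] (φ : KroneckerAlgebra k →+* S),
      IsUniversalLocalizationAt (KroneckerAlgebra.localizingSet k Δ) φ →
        Nonempty (S ≃+* Matrix (Fin 2) (Fin 2) (KroneckerAlgebra.invertedSubring k Δ)) ∧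
        IsMoritaEquivalent ℤ S (KroneckerAlgebra.invertedSubring k Δ)) ∧
    IsDedekindDomain (KroneckerAlgebra.invertedSubring k Δ) :=
  lemma4p6_general k Δ fun p hp => (hΔ p hp).2.ne_zero
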